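/- Work in the projective plane over \(\mathbb R\) or over \(\mathbb C\). A Poncelet \(m\)-gon is a cyclic sequence \(P=(p_i)_{i\in\mathbb Z/m}\) of \(m\) distinct points on a nondegenerate conic such that all lines \(p_i\vee p_{i+1}\) are tangent to a second nondegenerate conic. For a cyclic sequence of points \(P=(p_i)_{i\in\mathbb Z/m}\) put \(\vee_k(P)=(p_i\vee p_{i+k})_i\), where \(p\vee q\) is the line through \(p\) and \(q\), and for a cyclic sequence of lines \(L=(l_i)_{i\in\mathbb Z/m}\) put \(\wedge_k(L)=(l_i\wedge l_{i-k})_i\), where \(k\wedge l\) is the intersection point of \(k\) and \(l\). **Theorem A.** Let \(P\) be a Poncelet \(m\)-gon and let \(a,b,c\) be pairwise distinct positive integers smaller than \(m/2\). Put \(P_0=P\), \(L_1=\vee_a(P_0)\), \(P_1=\wedge_b(L_1)\), \(L_2=\vee_c(P_1)\), \(P_2=\wedge_a(L_2)\), \(L_3=\vee_b(P_2)\). Then each of these sequences consists of \(m\) distinct elements (so that all joins and intersections are well defined), and the construction \(m\#(a,b;c,a;b,c)\) closes up with the original labels: \[ \wedge_c\vee_b\wedge_a\vee_c\wedge_b\vee_a(P)=\wedge_c(L_3)=P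 . \] The points of \(P_0,P_1,P_2\) and the lines of \(L_1,L_2,L_3\) are \(3m\) distinct points and \(3m\) distinct lines, at least four of the lines pass through each of the points, and at least four of the points lie on each of the lines. More precisely, the incidences between consecutive rings are exactly those prescribed by the symbol: the \(i\)-th point of a ring lies on the \(j\)-th line of the following ring of lines \(\vee_k(\cdot)\) if and only if \(j\in\{i,i-k\}\), and the \(i\)-th point of a ring \(\wedge_k(\cdot)\) lies on the \(j\)-th line of the preceding ring of lines if and only if \(j\in\{i,i-k\}\) (here \(P_0=\wedge_c(L_3)\) is also the ring that follows \(L_3\)). Consequently, these points and lines form a \((3m_4)\) configuration (exactly four lines through each point, and exactly four points on each line) if and only if there is no accidental incidence between opposite rings, that is, no point of \(P_0\), \(P_1\), \(P_2\) lies on a line of \(L_2\), \(L_3\), \(L_1\), respectively. -/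

import Mathlib

open scoped LinearAlgebra.Projectivization Matrix

namespace Poncelet

/-- Points of the projective plane over `K`, in homogeneous coordinates. -/
abbrev Point (K : Type*) [Field K] := ℙ K (Fin 3 → K)

/-- Lines of the projective plane over `K`: the line with homogeneous coordinates `l` is
`{x | x ⬝ᵥ l = 0}`. -/
abbrev Line (K : Type*) [Field K] := ℙ K (Fin 3 → K)

section

variable {K : Type*} [Field K]

/-- The point `p` lies on the line `l`. -/
def Incident (p : Point K) (l : Line K) : Prop := Projectivization.orthogonal p l

open Classical in
/-- The line `p ∨ q` through two distinct points (for `p = q` it is a junk value). -/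
noncomputable def join (p q : Point K) : Line K := Projectivization.cross p q

open Classical in
/-- The common point `k ∧ l` of two distinct lines (for `k = l` it is a junk value). -/
noncomputable def meet (k l : Line K) : Point K := Projectivization.cross k l

/-- A nondegenerate conic, given by an invertible symmetric matrix. -/
structure Conic (K : Type*) [Field K] where
  matrix : Matrix (Fin 3) (Fin 3) K
  isSymm : matrix.IsSymm
  det_ne_zero : matrix.det ≠ 0

/-- The point `p` lies on the conic `C`. -/
def Conic.Contains (C : Conic K) (p : Point K) : Prop :=
  p.rep ⬝ᵥ (C.matrix *ᵥ p.rep) = 0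

/-- The line `l` touches the conic `C` at `q`: the point `q` is on `C`, and `l` is the line
`{x | xᵀ C q = 0}`. -/
def Conic.IsTangentAt (C : Conic K) (l : Line K) (q : Point K) : Prop :=
  C.Contains q ∧ ∀ x : Point K, Incident x l ↔ x.rep ⬝ᵥ (C.matrix *ᵥ q.rep) = 0

/-- The line `l` is tangent to the conic `C`. -/
def Conic.IsTangent (C : Conic K) (l : Line K) : Prop := ∃ q : Point K, C.IsTangentAt l q

variable {m : ℕ}

/-- The operation `∨_i` on a cyclic sequence of points, for indices `i` that are not divisible
by `m`: connect every point to the one that is `i` steps ahead. -/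
noncomputable def joins (i : ℕ) (P : ZMod m → Point K) : ZMod m → Line K :=
  fun j => join (P j) (P (j + (i : ZMod m)))

/-- The operation `∧_i` on a cyclic sequence of lines, for indices `i` that are not divisible
by `m`: intersect every line with the one that is `i` steps behind. -/
noncomputable def meets (i : ℕ) (L : ZMod m → Line K) : ZMod m → Point K :=
  fun j => meet (L j) (L (j - (i : ZMod m)))

/-- A Poncelet `m`-gon: a cyclic sequence of `m` distinct points on a nondegenerate conic whose
edges are tangent to a nondegenerate conic. -/
def IsPonceletPolygon (P : ZMod m → Point K) : Prop :=
  Function.Injective P ∧ ∃ C X : Conic K,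
    (∀ i, C.Contains (P i)) ∧ ∀ i, X.IsTangent (joins 1 P i)

/-- `n` points and `n` lines form a pre-`(n_k)` configuration: at least `k` of the lines pass
through each of the points, and at least `k` of the points lie on each of the lines. -/
def IsPreConfiguration (n k : ℕ) (S : Set (Point K)) (T : Set (Line K)) : Prop :=
  S.encard = n ∧ T.encard = n ∧
    (∀ p ∈ S, (k : ℕ∞) ≤ {l ∈ T | Incident p l}.encard) ∧
    (∀ l ∈ T, (k : ℕ∞) ≤ {p ∈ S | Incident p l}.encard)

/-- `n` points and `n` lines form an `(n_k)` configuration: exactly `k` of the lines pass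
through each of the points, and exactly `k` of the points lie on each of the lines. -/
def IsConfiguration (n k : ℕ) (S : Set (Point K)) (T : Set (Line K)) : Prop :=
  S.encard = n ∧ T.encard = n ∧
    (∀ p ∈ S, {l ∈ T | Incident p l}.encard = (k : ℕ∞)) ∧
    (∀ l ∈ T, {p ∈ S | Incident p l}.encard = (k : ℕ∞))

end

end Poncelet

/-!
Over an algebraically closed field every nondegenerate conic is the standard one, `z ⬝ᵥ z = 0`,
after a linear change of coordinates, and polarity in it identifies lines with points: the line
through `x` and `y` is the polar line of `x ⨯₃ y`. The second conic becomes a symmetric matrix `M`,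
which has a symmetric square root `N`. An edge `u i ∨ u (i + 1)` of a polygon inscribed in the
standard conic is tangent to the second conic exactly if `w i = N⁻¹ (u i ⨯₃ u (i + 1))` is again on
the standard conic, and then `w i ⨯₃ w (i + 1)` is a multiple of `N (u (i + 1))`. So the vertices
and the `w i` interlace to a sequence `z n` of half-steps on the standard conic, in which
`z (n - 1) ⨯₃ z (n + 1)` is a multiple of `N (z n)` for all `n` (`exists_isHalfStepSequence`).

The key fact (`IsHalfStepSequence.exists_isChordMatrix`) is that longer chords have the same form:
for `0 < k < m / 2` there is an invertible symmetric matrix `N_k`, in the bicommutant of `N`, such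
that `z (n - k) ⨯₃ z (n + k)` is a multiple of `N_k (z n)` for all `n`. The induction on `k` looks
at the quadrangle `z (n + 1 ± k)`, `z (n - 1 ± k)`. Two of its diagonal points are
`N_k⁻¹ N (z n)` and `N⁻¹ N_k (z n)`, and its diagonal triangle is harmonic, so that
`N_(k - 1) = x N_k⁻¹ N + y N⁻¹ N_k` implies `N_(k + 1) = x N_k⁻¹ N - y N⁻¹ N_k`. The relation for
`N_(k - 1)` is available because all `N_k ^ 2` and all `N N_k N_(k + 1)` are combinations of `1`
and `M`. This treats all relative positions of the two conics at once.

If the elements of a ring are `T (z (2 i + s))`, then joining them, or intersecting them, with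
span `k` gives `(T⁻¹)ᵀ N_k (z (2 i + s ± k))` (`IsImageRing.join`). Since the matrices commute,
those of the six steps of the construction cancel, and the construction closes up. Each ring is the image
of distinct points of a conic, three of which are never collinear; this gives the distinctness
within a ring and the exact incidences between consecutive rings. The latter imply that different
rings are disjoint, and the rest is counting (`IsCyclicRings`).
-/

namespace Poncelet

/-! ### Cross products and points on the standard conic -/

section CrossProduct

variable {K : Type*} [Field K]

theorem mulVec_cross_mulVec (B : Matrix (Fin 3) (Fin 3) K) (u v : Fin 3 → K) :
    (B *ᵥ u) ⨯₃ (B *ᵥ v) = B.adjugateᵀ *ᵥ (u ⨯₃ v) := by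
  ext i
  fin_cases i <;>
  simp [cross_apply, Matrix.mulVec, dotProduct, Fin.sum_univ_three,
    Matrix.adjugate_fin_three] <;> ring

theorem mulVec_cross_mulVec' {B : Matrix (Fin 3) (Fin 3) K} (hB : B.det ≠ 0) (u v : Fin 3 → K) :
    (B *ᵥ u) ⨯₃ (B *ᵥ v) = B.det • (B⁻¹)ᵀ *ᵥ (u ⨯₃ v) := by
  rw [mulVec_cross_mulVec, Matrix.inv_def, Ring.inverse_eq_inv', Matrix.transpose_smul,
    ← Matrix.smul_mulVec, smul_smul, mul_inv_cancel₀ hB, one_smul]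

theorem mulVec_dot_cross_mulVec (B : Matrix (Fin 3) (Fin 3) K) (u v w : Fin 3 → K) :
    (B *ᵥ u) ⬝ᵥ ((B *ᵥ v) ⨯₃ (B *ᵥ w)) = B.det * (u ⬝ᵥ (v ⨯₃ w)) := by
  simp [cross_apply, Matrix.mulVec, dotProduct, Fin.sum_univ_three, Matrix.det_fin_three]
  ring

/-- A vector orthogonal to two independent vectors is a multiple of their cross product. -/
theorem exists_eq_smul_cross {a b x : Fin 3 → K} (hab : a ⨯₃ b ≠ 0) (ha : x ⬝ᵥ a = 0)
    (hb : x ⬝ᵥ b = 0) : ∃ c : K, x = c • (a ⨯₃ b) := by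
  have h : x ⨯₃ (a ⨯₃ b) = 0 := by
    have := cross_cross_eq_smul_sub_smul' x a b
    rw [this, dotProduct_comm a x, ha, hb]
    simp
  by_contra hc
  push Not at hc
  have hli : LinearIndependent K ![a ⨯₃ b, x] :=
    (LinearIndependent.pair_iff' hab).2 fun c h => hc c h.symm
  rw [← crossProduct_ne_zero_iff_linearIndependent, ← cross_anticomm, h] at hli
  simp at hli

theorem exists_eq_smul_of_cross_eq_zero {a b : Fin 3 → K} (ha : a ≠ 0) (h : a ⨯₃ b = 0) :
    ∃ c : K, b = c • a := by
  by_contra hc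
  push Not at hc
  have hli : LinearIndependent K ![a, b] :=
    (LinearIndependent.pair_iff' ha).2 fun c h => hc c h.symm
  exact crossProduct_ne_zero_iff_linearIndependent.2 hli h

theorem right_ne_zero_of_cross_ne_zero {a b : Fin 3 → K} (h : a ⨯₃ b ≠ 0) : b ≠ 0 := by
  rintro rfl; simp at h

theorem cross_ne_zero_symm {a b : Fin 3 → K} (h : a ⨯₃ b ≠ 0) : b ⨯₃ a ≠ 0 := by
  rwa [← cross_anticomm, neg_ne_zero]

/-- The Gram determinant of two triples of vectors. -/
theorem dot_cross_mul_dot_cross (a b c x y z : Fin 3 → K) :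
    (a ⬝ᵥ (b ⨯₃ c)) * (x ⬝ᵥ (y ⨯₃ z)) =
      (a ⬝ᵥ x) * ((b ⬝ᵥ y) * (c ⬝ᵥ z) - (b ⬝ᵥ z) * (c ⬝ᵥ y))
      - (a ⬝ᵥ y) * ((b ⬝ᵥ x) * (c ⬝ᵥ z) - (b ⬝ᵥ z) * (c ⬝ᵥ x))
      + (a ⬝ᵥ z) * ((b ⬝ᵥ x) * (c ⬝ᵥ y) - (b ⬝ᵥ y) * (c ⬝ᵥ x)) := by
  simp [cross_apply, dotProduct, Fin.sum_univ_three]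
  ring

/-- Two non-proportional points of the conic `z ⬝ᵥ z = 0` are not conjugate: this conic contains
no line. -/
theorem dot_ne_zero_of_null {a b : Fin 3 → K} (ha : a ⬝ᵥ a = 0) (hb : b ⬝ᵥ b = 0)
    (h : a ⨯₃ b ≠ 0) : a ⬝ᵥ b ≠ 0 := by
  intro hab
  obtain ⟨c, hc⟩ := exists_eq_smul_cross h ha hab
  obtain ⟨d, hd⟩ := exists_eq_smul_cross h (by rwa [dotProduct_comm]) hb
  apply h
  calc a ⨯₃ b = (c • (a ⨯₃ b)) ⨯₃ (d • (a ⨯₃ b)) := by rw [← hc, ← hd]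
    _ = 0 := by rw [map_smul, map_smul, LinearMap.smul_apply, cross_self, smul_zero, smul_zero]

/-- Three pairwise non-proportional points of the conic `z ⬝ᵥ z = 0` are not collinear. -/
theorem dot_cross_ne_zero_of_null (h2 : (2 : K) ≠ 0) {a b c : Fin 3 → K} (ha : a ⬝ᵥ a = 0)
    (hb : b ⬝ᵥ b = 0) (hc : c ⬝ᵥ c = 0) (hab : a ⨯₃ b ≠ 0) (hac : a ⨯₃ c ≠ 0)
    (hbc : b ⨯₃ c ≠ 0) : a ⬝ᵥ (b ⨯₃ c) ≠ 0 := by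
  intro h
  have key := dot_cross_mul_dot_cross a b c a b c
  rw [h, ha, hb, hc, dotProduct_comm b a, dotProduct_comm c b, dotProduct_comm c a] at key
  have : 2 * (a ⬝ᵥ b * (a ⬝ᵥ c) * (b ⬝ᵥ c)) = 0 := by linear_combination -key
  simp [h2, dot_ne_zero_of_null ha hb hab, dot_ne_zero_of_null ha hc hac,
    dot_ne_zero_of_null hb hc hbc] at this

/-- The first diagonal point `(a b) ∧ (c d)` of a quadrangle inscribed in the conic
`z ⬝ᵥ z = 0` lies on none of the tangents at the vertices `a` and `b`. -/
theorem diagonal_dot_ne_zero (h2 : (2 : K) ≠ 0) {a b c d : Fin 3 → K} (ha : a ⬝ᵥ a = 0)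
    (hb : b ⬝ᵥ b = 0) (hc : c ⬝ᵥ c = 0) (hd : d ⬝ᵥ d = 0) (hab : a ⨯₃ b ≠ 0)
    (hac : a ⨯₃ c ≠ 0) (had : a ⨯₃ d ≠ 0) (hcd : c ⨯₃ d ≠ 0) :
    ((a ⨯₃ b) ⨯₃ (c ⨯₃ d)) ⬝ᵥ a ≠ 0 := by
  have : ((a ⨯₃ b) ⨯₃ (c ⨯₃ d)) ⬝ᵥ a = (a ⬝ᵥ (c ⨯₃ d)) * (a ⬝ᵥ b) := by
    rw [cross_cross_eq_smul_sub_smul, sub_dotProduct, smul_dotProduct, smul_dotProduct, ha,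
      dotProduct_comm b a]
    simp
  rw [this]
  exact mul_ne_zero (dot_cross_ne_zero_of_null h2 ha hc hd hac had hcd)
    (dot_ne_zero_of_null ha hb hab)

/-- The diagonal triangle of a quadrangle `a b c d` inscribed in the conic `z ⬝ᵥ z = 0` is
harmonic: the tangents at `a` and `b` meet the line through the diagonal points `(a b) ∧ (c d)` and
`(a c) ∧ (b d)` in two points that are harmonic with respect to these diagonal points. -/
theorem diagonal_harmonic {a b c d : Fin 3 → K} (ha : a ⬝ᵥ a = 0)
    (hb : b ⬝ᵥ b = 0) (hc : c ⬝ᵥ c = 0) (hd : d ⬝ᵥ d = 0) :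
    (((a ⨯₃ b) ⨯₃ (c ⨯₃ d)) ⬝ᵥ a) * (((a ⨯₃ c) ⨯₃ (b ⨯₃ d)) ⬝ᵥ b) +
      (((a ⨯₃ c) ⨯₃ (b ⨯₃ d)) ⬝ᵥ a) * (((a ⨯₃ b) ⨯₃ (c ⨯₃ d)) ⬝ᵥ b) = 0 := by
  have k1 := dot_cross_mul_dot_cross a c d a c b
  have k2 := dot_cross_mul_dot_cross b d a b d c
  have e1 : a ⬝ᵥ (b ⨯₃ d) = b ⬝ᵥ (d ⨯₃ a) := triple_product_permutation _ _ _
  have e2 : b ⬝ᵥ (c ⨯₃ d) = - (b ⬝ᵥ (d ⨯₃ c)) := by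
    rw [← cross_anticomm d c, dotProduct_neg]
  have e3 : b ⬝ᵥ (a ⨯₃ c) = a ⬝ᵥ (c ⨯₃ b) := by
    rw [triple_product_permutation]
  have f1 : ((a ⨯₃ b) ⨯₃ (c ⨯₃ d)) ⬝ᵥ a = (a ⬝ᵥ (c ⨯₃ d)) * (a ⬝ᵥ b) := by
    rw [cross_cross_eq_smul_sub_smul, sub_dotProduct, smul_dotProduct, smul_dotProduct, ha,
      dotProduct_comm b a]
    simp
  have f2 : ((a ⨯₃ b) ⨯₃ (c ⨯₃ d)) ⬝ᵥ b = - (b ⬝ᵥ (c ⨯₃ d)) * (a ⬝ᵥ b) := by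
    rw [cross_cross_eq_smul_sub_smul, sub_dotProduct, smul_dotProduct, smul_dotProduct, hb]
    simp
  have f3 : ((a ⨯₃ c) ⨯₃ (b ⨯₃ d)) ⬝ᵥ a = (a ⬝ᵥ (b ⨯₃ d)) * (a ⬝ᵥ c) := by
    rw [cross_cross_eq_smul_sub_smul, sub_dotProduct, smul_dotProduct, smul_dotProduct, ha,
      dotProduct_comm c a]
    simp
  have f4 : ((a ⨯₃ c) ⨯₃ (b ⨯₃ d)) ⬝ᵥ b = - (b ⬝ᵥ (a ⨯₃ c)) * (b ⬝ᵥ d) := by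
    rw [cross_cross_eq_smul_sub_smul', sub_dotProduct, smul_dotProduct, smul_dotProduct, hb,
      dotProduct_comm d b]
    simp
  rw [f1, f2, f3, f4, e1, e2, e3]
  simp only [ha, hb, hc, hd, dotProduct_comm c a, dotProduct_comm d a, dotProduct_comm c b,
    dotProduct_comm d b, dotProduct_comm d c] at k1 k2
  linear_combination (-(a ⬝ᵥ b) * (b ⬝ᵥ d)) * k1 + (a ⬝ᵥ b) * (a ⬝ᵥ c) * k2

/-- The form that a symmetric matrix induces on lines through `p`, written in terms of the two
points `y` and `y'` spanning these lines with `p`. -/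
theorem cross_dot_mulVec_cross {A : Matrix (Fin 3) (Fin 3) K} (hA : A.IsSymm)
    (p y y' : Fin 3 → K) :
    (p ⨯₃ y) ⬝ᵥ (A *ᵥ (p ⨯₃ y')) =
      A.trace * ((p ⬝ᵥ p) * (y ⬝ᵥ y') - (p ⬝ᵥ y) * (p ⬝ᵥ y'))
      - ((p ⬝ᵥ A *ᵥ p) * (y ⬝ᵥ y') + (y ⬝ᵥ A *ᵥ y') * (p ⬝ᵥ p)
        - (p ⬝ᵥ A *ᵥ y') * (p ⬝ᵥ y) - (p ⬝ᵥ A *ᵥ y) * (p ⬝ᵥ y')) := by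
  have h1 := hA.apply 0 1
  have h2 := hA.apply 0 2
  have h3 := hA.apply 1 2
  simp only [cross_apply, Matrix.mulVec, dotProduct, Fin.sum_univ_three, Matrix.trace,
    Matrix.diag_apply, h1, h2, h3, Matrix.cons_val_zero, Matrix.cons_val_one, Matrix.cons_val]
  ring

end CrossProduct

/-! ### Square roots of symmetric matrices -/

section SquareRoot

variable {K : Type*} [Field K]

theorem cayley_hamilton_fin_three (M : Matrix (Fin 3) (Fin 3) K) :
    M * M * M = M.trace • (M * M) - M.adjugate.trace • M + M.det • 1 := by
  ext i j
  fin_cases i <;> fin_cases j <;>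
  simp [Matrix.mul_apply, Fin.sum_univ_three, Matrix.trace, Matrix.adjugate_fin_three,
    Matrix.det_fin_three] <;> ring

theorem det_add_smul_one_fin_three (M : Matrix (Fin 3) (Fin 3) K) (s : K) :
    (M + s • 1).det = s ^ 3 + M.trace * s ^ 2 + M.adjugate.trace * s + M.det := by
  simp [Fin.sum_univ_three, Matrix.trace, Matrix.adjugate_fin_three, Matrix.det_fin_three]
  ring

theorem exists_roots_of_cubic [IsAlgClosed K] (t e d : K) :
    ∃ x y z : K, t = x + y + z ∧ e = x * y + x * z + y * z ∧ d = x * y * z := by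
  have hdeg : (Polynomial.X ^ 3 - Polynomial.C t * Polynomial.X ^ 2 +
      Polynomial.C e * Polynomial.X - Polynomial.C d : Polynomial K).degree = 3 := by
    compute_degree!
  obtain ⟨x, hx⟩ := IsAlgClosed.exists_root (Polynomial.X ^ 3 - Polynomial.C t * Polynomial.X ^ 2 +
    Polynomial.C e * Polynomial.X - Polynomial.C d : Polynomial K) (by rw [hdeg]; norm_num)
  have hdeg' : (Polynomial.X ^ 2 - Polynomial.C (t - x) * Polynomial.X +
      Polynomial.C (e - x * (t - x)) : Polynomial K).degree = 2 := by
    compute_degree!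
  obtain ⟨y, hy⟩ := IsAlgClosed.exists_root (Polynomial.X ^ 2 - Polynomial.C (t - x) *
    Polynomial.X + Polynomial.C (e - x * (t - x)) : Polynomial K) (by rw [hdeg']; norm_num)
  simp only [Polynomial.IsRoot.def, Polynomial.eval_sub, Polynomial.eval_add, Polynomial.eval_mul,
    Polynomial.eval_pow, Polynomial.eval_X, Polynomial.eval_C] at hx hy
  refine ⟨x, y, t - x - y, by ring, ?_, ?_⟩
  · linear_combination hy
  · linear_combination x * hy - hx

/-- The elementary symmetric functions `s₁, s₂, s₃` of suitable square roots of the roots of the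
monic cubic with coefficients `t, e, d`. Equal roots get equal square roots, hence no two of the
square roots have sum zero, which is the last claim. -/
theorem exists_sqrt_of_cubic [IsAlgClosed K] (h2 : (2 : K) ≠ 0) {t e d : K} (hd : d ≠ 0) :
    ∃ s₁ s₂ s₃ : K, t = s₁ ^ 2 - 2 * s₂ ∧ e = s₂ ^ 2 - 2 * s₁ * s₃ ∧ d = s₃ ^ 2 ∧
      s₂ ^ 3 + t * s₂ ^ 2 + e * s₂ + d ≠ 0 := by
  obtain ⟨x, y, z, rfl, rfl, rfl⟩ := exists_roots_of_cubic t e d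
  choose r hr using fun x : K => IsAlgClosed.exists_pow_nat_eq x (n := 2) (by norm_num)
  have hne : ∀ u : K, u ≠ 0 → ∀ v : K, r u + r v ≠ 0 := by
    intro u hu v h
    have huv : u = v := by
      rw [← hr u, ← hr v]
      linear_combination (r u - r v) * h
    subst huv
    have h0 : r u = 0 := by
      have : 2 * r u = 0 := by linear_combination h
      simpa [h2] using this
    apply hu
    rw [← hr u, h0]
    norm_num
  have hx : x ≠ 0 := by rintro rfl; simp at hd
  have hy : y ≠ 0 := by rintro rfl; simp at hd
  have e1 := hr x
  have e2 := hr y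
  have e3 := hr z
  refine ⟨r x + r y + r z, r x * r y + r x * r z + r y * r z, r x * r y * r z, ?_, ?_, ?_, ?_⟩
  · linear_combination -e1 - e2 - e3
  · linear_combination -(y + z) * e1 - (r x ^ 2 + z) * e2 - (r x ^ 2 + r y ^ 2) * e3
  · rw [mul_pow, mul_pow, e1, e2, e3]
  · have : (r x * r y + r x * r z + r y * r z) ^ 3 +
        (x + y + z) * (r x * r y + r x * r z + r y * r z) ^ 2 +
        (x * y + x * z + y * z) * (r x * r y + r x * r z + r y * r z) + x * y * z =
        ((r x + r y) * (r x + r z) * (r y + r z)) ^ 2 := by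
      generalize r x = p at *
      generalize r y = q at *
      generalize r z = s at *
      subst e1 e2 e3
      ring
    rw [this]
    exact pow_ne_zero _ (mul_ne_zero (mul_ne_zero (hne x hx y) (hne x hx z)) (hne y hy z))

/-- An invertible symmetric `3 × 3` matrix over an algebraically closed field has a symmetric
square root. -/
theorem exists_isSymm_mul_self_eq [IsAlgClosed K] (h2 : (2 : K) ≠ 0)
    {M : Matrix (Fin 3) (Fin 3) K} (hM : M.IsSymm) (hd : M.det ≠ 0) :
    ∃ N : Matrix (Fin 3) (Fin 3) K, N.IsSymm ∧ N * N = M := by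
  obtain ⟨s₁, s₂, s₃, ht, he, hd', hne⟩ :=
    exists_sqrt_of_cubic h2 (t := M.trace) (e := M.adjugate.trace) hd
  -- By the theorem of Cayley and Hamilton for `N`, a square root `N` with these elementary
  -- symmetric functions satisfies `N * (M + s₂) = s₁ * M + s₃`.
  set D := M + s₂ • (1 : Matrix (Fin 3) (Fin 3) K) with hD
  set U := s₁ • M + s₃ • (1 : Matrix (Fin 3) (Fin 3) K) with hU
  have hDdet : IsUnit D.det := by
    rw [hD, det_add_smul_one_fin_three]
    exact hne.isUnit
  have hUU : U * U = M * D * D := by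
    have hCH := cayley_hamilton_fin_three M
    have h1 : U * U = s₁ ^ 2 • (M * M) + (2 * s₁ * s₃) • M + s₃ ^ 2 • 1 := by
      simp only [hU, mul_add, add_mul, smul_mul_smul_comm, mul_one, one_mul]
      module
    have h3 : M * D * D = M * M * M + (2 * s₂) • (M * M) + s₂ ^ 2 • M := by
      simp only [hD, mul_add, add_mul, mul_one, mul_smul_comm, smul_mul_assoc, smul_add,
        smul_smul]
      module
    rw [h1, h3, hCH, ht, he, hd']
    module
  have hUD : U * D = D * U := by
    simp only [hU, hD, mul_add, add_mul, mul_one, one_mul, mul_smul_comm, smul_mul_assoc]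
    module
  have hUDi : D⁻¹ * U = U * D⁻¹ := by
    calc D⁻¹ * U = D⁻¹ * (U * D) * D⁻¹ := by
          rw [mul_assoc, Matrix.mul_nonsing_inv_cancel_right _ _ hDdet]
      _ = U * D⁻¹ := by rw [hUD, Matrix.nonsing_inv_mul_cancel_left _ _ hDdet]
  have hDs : D.IsSymm := hM.add (Matrix.isSymm_one.smul _)
  have hUs : U.IsSymm := (hM.smul _).add (Matrix.isSymm_one.smul _)
  refine ⟨U * D⁻¹, ?_, ?_⟩
  · rw [Matrix.IsSymm, Matrix.transpose_mul, Matrix.transpose_nonsing_inv, hDs.eq, hUs.eq, hUDi]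
  · rw [mul_assoc, ← mul_assoc D⁻¹, hUDi, mul_assoc U, ← mul_assoc, hUU,
      Matrix.mul_assoc _ D, ← mul_assoc D, Matrix.mul_nonsing_inv _ hDdet, one_mul,
      Matrix.mul_nonsing_inv_cancel_right _ _ hDdet]

end SquareRoot

/-! ### Chords of a sequence of half-steps -/

section Chords

variable {K : Type*} [Field K]

/-- A sequence of points `z n` on the conic `z ⬝ᵥ z = 0` such that the line through `z (n - 1)` and
`z (n + 1)` is the polar line of `N *ᵥ z n`. The points of a Poncelet `m`-gon, at even indices,
and the images under `N⁻¹` of its edges, at odd indices, form such a sequence. -/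
structure IsHalfStepSequence (N : Matrix (Fin 3) (Fin 3) K) (m : ℕ) (z : ℤ → Fin 3 → K) :
    Prop where
  null : ∀ n, z n ⬝ᵥ z n = 0
  cross_ne_zero : ∀ n k : ℤ, ¬ (m : ℤ) ∣ k → z n ⨯₃ z (n + 2 * k) ≠ 0
  step : ∀ n, ∃ c : K, c ≠ 0 ∧ z (n - 1) ⨯₃ z (n + 1) = c • N *ᵥ z n

/-- The line through `z (n - k)` and `z (n + k)` is the polar line of `A *ᵥ z n`, for all `n`. -/
def IsChordMatrix (z : ℤ → Fin 3 → K) (k : ℤ) (A : Matrix (Fin 3) (Fin 3) K) : Prop :=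
  ∀ n, ∃ c : K, c ≠ 0 ∧ z (n - k) ⨯₃ z (n + k) = c • A *ᵥ z n

theorem mulVec_dot_of_isSymm {A : Matrix (Fin 3) (Fin 3) K} (hA : A.IsSymm) (x y : Fin 3 → K) :
    (A *ᵥ x) ⬝ᵥ y = x ⬝ᵥ (A *ᵥ y) := by
  rw [Matrix.dotProduct_mulVec, ← Matrix.mulVec_transpose, hA.eq]

namespace IsHalfStepSequence

variable {N : Matrix (Fin 3) (Fin 3) K} {m : ℕ} {z : ℤ → Fin 3 → K}

theorem cross_ne_zero_of_sub (h : IsHalfStepSequence N m z) {n n' k : ℤ}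
    (hk : ¬ (m : ℤ) ∣ k) (hn : n' - n = 2 * k) : z n ⨯₃ z n' ≠ 0 := by
  obtain rfl : n' = n + 2 * k := by omega
  exact h.cross_ne_zero n k hk

/-- A vector in the kernel of the matrix would be a point on all chords `z (n - k) ∨ z (n + k)`,
but consecutive chords of this kind meet in a single point of the conic. -/
theorem det_ne_zero (h : IsHalfStepSequence N m z) (h2 : (2 : K) ≠ 0) {k : ℤ}
    {A : Matrix (Fin 3) (Fin 3) K} (hAs : A.IsSymm) (hA : IsChordMatrix z k A)
    (hk : ¬ (m : ℤ) ∣ k) (hkk : ¬ (m : ℤ) ∣ 2 * k) : A.det ≠ 0 := by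
  intro hdet
  obtain ⟨x, hx0, hx⟩ := Matrix.exists_mulVec_eq_zero_iff.2 hdet
  have hchord : ∀ n, x ⬝ᵥ (z (n - k) ⨯₃ z (n + k)) = 0 := by
    intro n
    obtain ⟨c, -, hc⟩ := hA n
    rw [hc, dotProduct_smul, ← mulVec_dot_of_isSymm hAs, hx, zero_dotProduct, smul_zero]
  have hpt : ∀ n, ∃ c : K, x = c • z n := by
    intro n
    have h1 := hchord (n - k)
    have h3 := hchord (n + k)
    rw [sub_add_cancel] at h1
    rw [add_sub_cancel_right] at h3
    have hne : z (n - k - k) ⬝ᵥ (z n ⨯₃ z (n + k + k)) ≠ 0 :=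
      dot_cross_ne_zero_of_null h2 (h.null _) (h.null _) (h.null _)
        (h.cross_ne_zero_of_sub hk (by ring)) (h.cross_ne_zero_of_sub hkk (by ring))
        (h.cross_ne_zero_of_sub hk (by ring))
    have hcc : (z (n - k - k) ⨯₃ z n) ⨯₃ (z n ⨯₃ z (n + k + k)) =
        (z (n - k - k) ⬝ᵥ (z n ⨯₃ z (n + k + k))) • z n := by
      rw [cross_cross_eq_smul_sub_smul, dot_self_cross, zero_smul, sub_zero]
    have hn0 : z n ≠ 0 := right_ne_zero_of_cross_ne_zero
      (h.cross_ne_zero_of_sub hk (show n - (n - k - k) = 2 * k by ring))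
    obtain ⟨c, hc⟩ := exists_eq_smul_cross (by rw [hcc]; exact smul_ne_zero hne hn0) h1 h3
    exact ⟨_, by rw [hc, hcc, smul_smul]⟩
  obtain ⟨c, hc⟩ := hpt 0
  obtain ⟨d, hd⟩ := hpt (0 + 2 * k)
  have hc0 : c = 0 := by
    have : c • (z 0 ⨯₃ z (0 + 2 * k)) = 0 := by
      rw [← LinearMap.smul_apply, ← map_smul, ← hc, hd, map_smul, LinearMap.smul_apply, cross_self,
        smul_zero]
    exact (smul_eq_zero.1 this).resolve_right (h.cross_ne_zero _ _ hk)
  exact hx0 (by rw [hc, hc0, zero_smul])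

theorem isChordMatrix_one (h : IsHalfStepSequence N m z) : IsChordMatrix z 1 N := h.step

/-- The two points of the conic `z ⬝ᵥ z = 0` other than `z n` on the tangents from `z n` to the
second conic are `z (n - 2)` and `z (n + 2)`. The product of these tangents is a conic, whose
equation is a combination of `y ⬝ᵥ y` and of the product of two linear forms, the tangent at
`z n` and the chord in question. -/
theorem isChordMatrix_two (h : IsHalfStepSequence N m z) (h2 : (2 : K) ≠ 0) (hm : 3 ≤ m)
    (hNs : N.IsSymm) (hN : N.det ≠ 0) :
    IsChordMatrix z 2 ((2 : K) • (N * N).adjugate - (N * N).adjugate.trace • 1) := by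
  have hm1 : ¬ (m : ℤ) ∣ 1 := fun hd => by have := Int.le_of_dvd one_pos hd; omega
  have hm2 : ¬ (m : ℤ) ∣ 2 := fun hd => by have := Int.le_of_dvd two_pos hd; omega
  intro n
  set A := (N * N).adjugate with hA
  set t := A.trace
  have hAs : A.IsSymm := by
    rw [hA, Matrix.IsSymm, Matrix.adjugate_transpose, Matrix.transpose_mul, hNs.eq]
  obtain ⟨c, hc0, hc⟩ := h.step (n + 1)
  obtain ⟨d, hd0, hd⟩ := h.step (n - 1)
  rw [add_sub_cancel_right, show n + 1 + 1 = n + 2 by ring] at hc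
  rw [sub_add_cancel, show n - 1 - 1 = n - 2 by ring] at hd
  have hd' : z n ⨯₃ z (n - 2) = (-d) • N *ᵥ z (n - 1) := by
    rw [← cross_anticomm, hd, neg_smul]
  have hNA : ∀ s t : Fin 3 → K, (N *ᵥ s) ⬝ᵥ (A *ᵥ (N *ᵥ t)) = N.det ^ 2 * (s ⬝ᵥ t) := by
    intro s t
    rw [mulVec_dot_of_isSymm hNs, Matrix.mulVec_mulVec, Matrix.mulVec_mulVec, hA,
      Matrix.adjugate_mul_distrib, mul_assoc, mul_assoc, Matrix.adjugate_mul, mul_smul_comm,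
      mul_one, mul_smul_comm, Matrix.mul_adjugate, smul_smul, Matrix.smul_mulVec, Matrix.one_mulVec,
      dotProduct_smul, smul_eq_mul]
    ring
  have hpp := h.null n
  have hN2 : ∀ y, (((2 : K) • A - t • 1) *ᵥ z n) ⬝ᵥ y =
      2 * (z n ⬝ᵥ A *ᵥ y) - t * (z n ⬝ᵥ y) := by
    intro y
    rw [Matrix.sub_mulVec, Matrix.smul_mulVec, Matrix.smul_mulVec, Matrix.one_mulVec,
      sub_dotProduct, smul_dotProduct, smul_dotProduct, mulVec_dot_of_isSymm hAs]
    rfl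
  have hzero : ∀ {y w : Fin 3 → K} {c : K}, z n ⨯₃ y = c • N *ᵥ w → w ⬝ᵥ w = 0 → y ⬝ᵥ y = 0 →
      z n ⨯₃ y ≠ 0 → (((2 : K) • A - t • 1) *ᵥ z n) ⬝ᵥ y = 0 := by
    intro y w c hy hw hyy hne
    have key := cross_dot_mulVec_cross hAs (z n) y y
    rw [hy, Matrix.mulVec_smul, dotProduct_smul, smul_dotProduct, hNA, hw, hpp, hyy] at key
    have : (z n ⬝ᵥ y) * ((((2 : K) • A - t • 1) *ᵥ z n) ⬝ᵥ y) = 0 := by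
      rw [hN2]
      simp only [smul_eq_mul] at key
      linear_combination -key
    exact (mul_eq_zero.1 this).resolve_left (dot_ne_zero_of_null hpp hyy hne)
  have hy : z n ⨯₃ z (n + 2) ≠ 0 := h.cross_ne_zero_of_sub hm1 (by ring)
  have hy' : z n ⨯₃ z (n - 2) ≠ 0 := cross_ne_zero_symm (h.cross_ne_zero_of_sub hm1 (by ring))
  have hyy' : z (n - 2) ⨯₃ z (n + 2) ≠ 0 := h.cross_ne_zero_of_sub hm2 (by ring)
  have o1 := hzero hc (h.null _) (h.null _) hy
  have o2 := hzero hd' (h.null _) (h.null _) hy'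
  obtain ⟨r, hr⟩ := exists_eq_smul_cross hyy' o2 o1
  have hr0 : r ≠ 0 := by
    rintro rfl
    rw [zero_smul] at hr
    have key := cross_dot_mulVec_cross hAs (z n) (z (n + 2)) (z (n - 2))
    have i1 := hN2 (z (n + 2))
    have i2 := hN2 (z (n - 2))
    have i3 := hN2 (z n)
    rw [hr, zero_dotProduct] at i1 i2 i3
    rw [hpp] at i3
    have i4 : z n ⬝ᵥ A *ᵥ z n = 0 := by
      have : 2 * (z n ⬝ᵥ A *ᵥ z n) = 0 := by linear_combination -i3
      simpa [h2] using this
    rw [hc, hd', Matrix.mulVec_smul, dotProduct_smul, smul_dotProduct, hNA, i4, hpp] at key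
    simp only [smul_eq_mul] at key
    have h0 : 2 * (-d * (c * (N.det ^ 2 * z (n + 1) ⬝ᵥ z (n - 1)))) = 0 := by
      linear_combination 2 * key - (z n ⬝ᵥ z (n + 2)) * i2 - (z n ⬝ᵥ z (n - 2)) * i1
    have hne : z (n + 1) ⬝ᵥ z (n - 1) ≠ 0 := dot_ne_zero_of_null (h.null _) (h.null _)
      (cross_ne_zero_symm (h.cross_ne_zero_of_sub hm1 (by ring)))
    simp [h2, hd0, hc0, hN, hne] at h0
  exact ⟨r⁻¹, inv_ne_zero hr0, by rw [hr, smul_smul, inv_mul_cancel₀ hr0, one_smul]⟩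

/-- The quadrangle formed by `z (n + 1 + k)`, `z (n + 1 - k)`, `z (n - 1 + k)` and `z (n - 1 - k)`
has the diagonal points `B⁻¹ * N *ᵥ z n` and `N⁻¹ * B *ᵥ z n`. -/
theorem exists_diagonal (h : IsHalfStepSequence N m z) (hNs : N.IsSymm) (hN : N.det ≠ 0) {k : ℤ}
    {B : Matrix (Fin 3) (Fin 3) K} (hBs : B.IsSymm) (hBd : B.det ≠ 0) (hB : IsChordMatrix z k B)
    (n : ℤ) :
    (∃ c : K, c ≠ 0 ∧ (z (n + 1 + k) ⨯₃ z (n + 1 - k)) ⨯₃ (z (n - 1 + k) ⨯₃ z (n - 1 - k)) =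
      c • (B⁻¹ * N) *ᵥ z n) ∧
    (∃ c : K, c ≠ 0 ∧ (z (n + 1 + k) ⨯₃ z (n - 1 + k)) ⨯₃ (z (n + 1 - k) ⨯₃ z (n - 1 - k)) =
      c • (N⁻¹ * B) *ᵥ z n) := by
  constructor
  · obtain ⟨c, hc0, hc⟩ := hB (n + 1)
    obtain ⟨d, hd0, hd⟩ := hB (n - 1)
    obtain ⟨e, he0, he⟩ := h.step n
    refine ⟨-(c * d * B.det * e), by simp [hc0, hd0, hBd, he0], ?_⟩
    rw [← cross_anticomm (z (n + 1 - k)), ← cross_anticomm (z (n - 1 - k)), hc, hd, map_neg,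
      map_neg, map_smul, map_smul, LinearMap.neg_apply, LinearMap.smul_apply,
      mulVec_cross_mulVec' hBd, ← cross_anticomm (z (n - 1)), he, Matrix.transpose_nonsing_inv,
      hBs.eq, ← Matrix.mulVec_mulVec, Matrix.mulVec_neg, Matrix.mulVec_smul]
    module
  · obtain ⟨c, hc0, hc⟩ := h.step (n + k)
    obtain ⟨d, hd0, hd⟩ := h.step (n - k)
    obtain ⟨e, he0, he⟩ := hB n
    refine ⟨-(c * d * N.det * e), by simp [hc0, hd0, hN, he0], ?_⟩
    rw [show n + 1 + k = n + k + 1 by ring, show n - 1 + k = n + k - 1 by ring,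
      show n + 1 - k = n - k + 1 by ring, show n - 1 - k = n - k - 1 by ring,
      ← cross_anticomm (z (n + k - 1)), ← cross_anticomm (z (n - k - 1)), hc, hd, map_neg,
      map_neg, map_smul, map_smul, LinearMap.neg_apply, LinearMap.smul_apply,
      mulVec_cross_mulVec' hN, ← cross_anticomm (z (n - k)), he, Matrix.transpose_nonsing_inv,
      hNs.eq, ← Matrix.mulVec_mulVec, Matrix.mulVec_neg, Matrix.mulVec_smul]
    module

/-- The harmonic relations in the quadrangle of `exists_diagonal`, in terms of its diagonal points
`u` and `v`, and the pairs of a diagonal point and a vertex that are not conjugate. -/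
theorem diagonal_properties (h : IsHalfStepSequence N m z) (h2 : (2 : K) ≠ 0) (hNs : N.IsSymm)
    (hN : N.det ≠ 0) {k : ℤ} {B : Matrix (Fin 3) (Fin 3) K} (hBs : B.IsSymm) (hBd : B.det ≠ 0)
    (hB : IsChordMatrix z k B) (hm1 : ¬ (m : ℤ) ∣ 1) (hk0 : ¬ (m : ℤ) ∣ k - 1)
    (hk1 : ¬ (m : ℤ) ∣ k) (hk2 : ¬ (m : ℤ) ∣ k + 1) (n : ℤ) :
    let u := (B⁻¹ * N) *ᵥ z n
    let v := (N⁻¹ * B) *ᵥ z n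
    (u ⬝ᵥ z (n + 1 + k) ≠ 0 ∧ u ⬝ᵥ z (n + 1 - k) ≠ 0 ∧ v ⬝ᵥ z (n + 1 + k) ≠ 0 ∧
      v ⬝ᵥ z (n + 1 - k) ≠ 0 ∧ v ⬝ᵥ z (n - 1 + k) ≠ 0) ∧
    (u ⬝ᵥ z (n + 1 + k)) * (v ⬝ᵥ z (n + 1 - k)) +
      (v ⬝ᵥ z (n + 1 + k)) * (u ⬝ᵥ z (n + 1 - k)) = 0 ∧
    (u ⬝ᵥ z (n - 1 - k)) * (v ⬝ᵥ z (n - 1 + k)) +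
      (v ⬝ᵥ z (n - 1 - k)) * (u ⬝ᵥ z (n - 1 + k)) = 0 := by
  intro u v
  obtain ⟨⟨c, hc0, hc⟩, ⟨d, hd0, hd⟩⟩ := h.exists_diagonal hNs hN hBs hBd hB n
  have hab : z (n + 1 + k) ⨯₃ z (n + 1 - k) ≠ 0 :=
    cross_ne_zero_symm (h.cross_ne_zero_of_sub hk1 (by ring))
  have hac : z (n + 1 + k) ⨯₃ z (n - 1 + k) ≠ 0 :=
    cross_ne_zero_symm (h.cross_ne_zero_of_sub hm1 (by ring))
  have had : z (n + 1 + k) ⨯₃ z (n - 1 - k) ≠ 0 :=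
    cross_ne_zero_symm (h.cross_ne_zero_of_sub hk2 (by ring))
  have hbc : z (n + 1 - k) ⨯₃ z (n - 1 + k) ≠ 0 := h.cross_ne_zero_of_sub hk0 (by ring)
  have hbd : z (n + 1 - k) ⨯₃ z (n - 1 - k) ≠ 0 :=
    cross_ne_zero_symm (h.cross_ne_zero_of_sub hm1 (by ring))
  have hcd : z (n - 1 + k) ⨯₃ z (n - 1 - k) ≠ 0 :=
    cross_ne_zero_symm (h.cross_ne_zero_of_sub hk1 (by ring))
  have na := h.null (n + 1 + k)
  have nb := h.null (n + 1 - k)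
  have nc := h.null (n - 1 + k)
  have nd := h.null (n - 1 - k)
  have key1 := diagonal_harmonic na nb nc nd
  have key2 := diagonal_harmonic nd nc nb na
  have ua := diagonal_dot_ne_zero h2 na nb nc nd hab hac had hcd
  have ub := diagonal_dot_ne_zero h2 nb na nd nc (cross_ne_zero_symm hab) hbd hbc
    (cross_ne_zero_symm hcd)
  have va := diagonal_dot_ne_zero h2 na nc nb nd hac hab had hbd
  have vb := diagonal_dot_ne_zero h2 nb nd na nc hbd (cross_ne_zero_symm hab) hbc hac
  have vc := diagonal_dot_ne_zero h2 nc na nd nb (cross_ne_zero_symm hac) hcd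
    (cross_ne_zero_symm hbc) (cross_ne_zero_symm hbd)
  have r1 : (z (n - 1 - k) ⨯₃ z (n - 1 + k)) ⨯₃ (z (n + 1 - k) ⨯₃ z (n + 1 + k)) =
      (-c) • u := by
    rw [← cross_anticomm (z (n - 1 + k)), ← cross_anticomm (z (n + 1 + k)), map_neg, map_neg,
      LinearMap.neg_apply, neg_neg, ← cross_anticomm, hc, neg_smul]
  have r2 : (z (n - 1 - k) ⨯₃ z (n + 1 - k)) ⨯₃ (z (n - 1 + k) ⨯₃ z (n + 1 + k)) =
      (-d) • v := by
    rw [← cross_anticomm (z (n + 1 - k)), ← cross_anticomm (z (n + 1 + k)), map_neg, map_neg,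
      LinearMap.neg_apply, neg_neg, ← cross_anticomm, hd, neg_smul]
  have r3 : (z (n + 1 - k) ⨯₃ z (n + 1 + k)) ⨯₃ (z (n - 1 - k) ⨯₃ z (n - 1 + k)) = c • u := by
    rw [← cross_anticomm, r1, neg_smul, neg_neg]
  have r4 : (z (n + 1 - k) ⨯₃ z (n - 1 - k)) ⨯₃ (z (n + 1 + k) ⨯₃ z (n - 1 + k)) =
      (-d) • v := by
    rw [← cross_anticomm, hd, neg_smul]
  have r5 : (z (n - 1 + k) ⨯₃ z (n + 1 + k)) ⨯₃ (z (n - 1 - k) ⨯₃ z (n + 1 - k)) = d • v := by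
    rw [← cross_anticomm, r2, neg_smul, neg_neg]
  rw [hc] at ua
  rw [r3] at ub
  rw [hd] at va
  rw [r4] at vb
  rw [r5] at vc
  rw [hc, hd] at key1
  rw [r1, r2] at key2
  simp only [smul_dotProduct, smul_eq_mul] at ua ub va vb vc key1 key2
  refine ⟨⟨right_ne_zero_of_mul ua, right_ne_zero_of_mul ub, right_ne_zero_of_mul va,
    right_ne_zero_of_mul vb, right_ne_zero_of_mul vc⟩, ?_, ?_⟩
  · apply mul_left_cancel₀ (mul_ne_zero hc0 hd0)
    linear_combination key1
  · apply mul_left_cancel₀ (mul_ne_zero hc0 hd0)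
    linear_combination key2

/-- In the quadrangle of `exists_diagonal`, the pole of `z (n + 1 - k) ∨ z (n - 1 + k)` and the pole
of the opposite side `z (n - 1 - k) ∨ z (n + 1 + k)` are harmonic with respect to the two diagonal
points, whence the change of sign. -/
theorem isChordMatrix_succ (h : IsHalfStepSequence N m z) (h2 : (2 : K) ≠ 0) (hNs : N.IsSymm)
    (hN : N.det ≠ 0) {k : ℤ} {B : Matrix (Fin 3) (Fin 3) K} (hBs : B.IsSymm) (hBd : B.det ≠ 0)
    (hB : IsChordMatrix z k B) (hm1 : ¬ (m : ℤ) ∣ 1) (hk0 : ¬ (m : ℤ) ∣ k - 1)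
    (hk1 : ¬ (m : ℤ) ∣ k) (hk2 : ¬ (m : ℤ) ∣ k + 1) {x y : K}
    (hA : IsChordMatrix z (k - 1) (x • (B⁻¹ * N) + y • (N⁻¹ * B))) :
    IsChordMatrix z (k + 1) (x • (B⁻¹ * N) - y • (N⁻¹ * B)) := by
  intro n
  obtain ⟨⟨ua, ub, va, vb, vc⟩, key1, key2⟩ :=
    h.diagonal_properties h2 hNs hN hBs hBd hB hm1 hk0 hk1 hk2 n
  obtain ⟨c, hc0, hc⟩ := hA n
  rw [show n - (k - 1) = n + 1 - k by ring, show n + (k - 1) = n - 1 + k by ring] at hc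
  rw [show n - (k + 1) = n - 1 - k by ring, show n + (k + 1) = n + 1 + k by ring]
  have hbc : z (n + 1 - k) ⨯₃ z (n - 1 + k) ≠ 0 := h.cross_ne_zero_of_sub hk0 (by ring)
  have had : z (n - 1 - k) ⨯₃ z (n + 1 + k) ≠ 0 := h.cross_ne_zero_of_sub hk2 (by ring)
  have i1 := dot_self_cross (z (n + 1 - k)) (z (n - 1 + k))
  have i2 := dot_cross_self (z (n + 1 - k)) (z (n - 1 + k))
  rw [hc] at hbc i1 i2
  rw [dotProduct_comm, smul_dotProduct, smul_eq_mul, mul_eq_zero, or_iff_right hc0] at i1 i2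
  rw [Matrix.add_mulVec, Matrix.smul_mulVec, Matrix.smul_mulVec] at hbc i1 i2
  rw [Matrix.sub_mulVec, Matrix.smul_mulVec, Matrix.smul_mulVec]
  set u := (B⁻¹ * N) *ᵥ z n
  set v := (N⁻¹ * B) *ᵥ z n
  rw [add_dotProduct, smul_dotProduct, smul_dotProduct, smul_eq_mul, smul_eq_mul] at i1 i2
  have o1 : (x • u - y • v) ⬝ᵥ z (n + 1 + k) = 0 := by
    rw [sub_dotProduct, smul_dotProduct, smul_dotProduct, smul_eq_mul, smul_eq_mul]
    apply mul_left_cancel₀ vb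
    linear_combination x * key1 - (v ⬝ᵥ z (n + 1 + k)) * i1
  have o2 : (x • u - y • v) ⬝ᵥ z (n - 1 - k) = 0 := by
    rw [sub_dotProduct, smul_dotProduct, smul_dotProduct, smul_eq_mul, smul_eq_mul]
    apply mul_left_cancel₀ vc
    linear_combination x * key2 - (v ⬝ᵥ z (n - 1 - k)) * i2
  obtain ⟨r, hr⟩ := exists_eq_smul_cross had o2 o1
  have hr0 : r ≠ 0 := by
    rintro rfl
    rw [zero_smul] at hr
    have i3 : x * (u ⬝ᵥ z (n + 1 - k)) - y * (v ⬝ᵥ z (n + 1 - k)) = 0 := by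
      have := congrArg (· ⬝ᵥ z (n + 1 - k)) hr
      simpa [sub_dotProduct] using this
    have hx : x = 0 := by
      have : 2 * (x * (u ⬝ᵥ z (n + 1 - k))) = 0 := by linear_combination i1 + i3
      simpa [h2, ub] using this
    have hy : y = 0 := by
      have : 2 * (y * (v ⬝ᵥ z (n + 1 - k))) = 0 := by linear_combination i1 - i3
      simpa [h2, vb] using this
    simp [hx, hy] at hbc
  exact ⟨r⁻¹, inv_ne_zero hr0, by rw [hr, smul_smul, inv_mul_cancel₀ hr0, one_smul]⟩

/-- Otherwise the two diagonal points of the quadrangle in `exists_diagonal` would coincide. -/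
theorem mul_self_ne_smul (h : IsHalfStepSequence N m z) (h2 : (2 : K) ≠ 0) (hNs : N.IsSymm)
    (hN : N.det ≠ 0) {k : ℤ} {B : Matrix (Fin 3) (Fin 3) K} (hBs : B.IsSymm) (hBd : B.det ≠ 0)
    (hB : IsChordMatrix z k B) (hm1 : ¬ (m : ℤ) ∣ 1) (hk0 : ¬ (m : ℤ) ∣ k - 1)
    (hk1 : ¬ (m : ℤ) ∣ k) (hk2 : ¬ (m : ℤ) ∣ k + 1) (y : K) (hcomm : N * B = B * N) :
    B * B ≠ y • (N * N) := by
  intro hy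
  obtain ⟨⟨ua, ub, va, vb, vc⟩, key1, key2⟩ :=
    h.diagonal_properties h2 hNs hN hBs hBd hB hm1 hk0 hk1 hk2 0
  have huv : N⁻¹ * B = y • (B⁻¹ * N) := by
    have e : N * B * (N⁻¹ * B) = N * B * (y • (B⁻¹ * N)) := by
      rw [mul_smul_comm, mul_assoc N B (B⁻¹ * N), Matrix.mul_nonsing_inv_cancel_left _ _ hBd.isUnit,
        hcomm, mul_assoc B, Matrix.mul_nonsing_inv_cancel_left _ _ hN.isUnit, hy]
    have hu : IsUnit (N * B).det := by rw [Matrix.det_mul]; exact (mul_ne_zero hN hBd).isUnit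
    rw [← Matrix.nonsing_inv_mul_cancel_left _ (N⁻¹ * B) hu, e,
      Matrix.nonsing_inv_mul_cancel_left _ _ hu]
  rw [huv, Matrix.smul_mulVec] at va key1
  simp only [smul_dotProduct, smul_eq_mul] at va key1
  have hy0 : y ≠ 0 := left_ne_zero_of_mul va
  have : 2 * (y * (((B⁻¹ * N) *ᵥ z 0) ⬝ᵥ z (0 + 1 + k) *
      ((B⁻¹ * N) *ᵥ z 0) ⬝ᵥ z (0 + 1 - k))) = 0 := by
    linear_combination key1
  simp only [mul_eq_zero, h2, hy0, ua, ub, or_self] at this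

end IsHalfStepSequence

end Chords

/-! ### The matrices of the chords -/

section ChordMatrices

variable {K : Type*} [Field K]

/-- The bicommutant of a matrix: the matrices that commute with everything that commutes with it.
It is commutative and closed under inverses. -/
abbrev bicommutant (N : Matrix (Fin 3) (Fin 3) K) : Subalgebra K (Matrix (Fin 3) (Fin 3) K) :=
  Subalgebra.centralizer K (Set.centralizer {N})

theorem self_mem_bicommutant (N : Matrix (Fin 3) (Fin 3) K) : N ∈ bicommutant N :=
  Subalgebra.mem_centralizer_iff K |>.2 fun _ hA => (hA N rfl).symm

theorem mul_comm_of_mem_bicommutant {N A B : Matrix (Fin 3) (Fin 3) K} (hA : A ∈ bicommutant N)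
    (hB : B ∈ bicommutant N) : A * B = B * A := by
  refine (Subalgebra.mem_centralizer_iff K).1 hB A fun M hM => ?_
  rw [Set.mem_singleton_iff.1 hM]
  exact (Subalgebra.mem_centralizer_iff K).1 hA N fun M hM => by rw [Set.mem_singleton_iff.1 hM]

theorem inv_mem_bicommutant {N A : Matrix (Fin 3) (Fin 3) K} (hA : A ∈ bicommutant N)
    (hd : A.det ≠ 0) : A⁻¹ ∈ bicommutant N := by
  refine (Subalgebra.mem_centralizer_iff K).2 fun B hB => ?_
  have h := (Subalgebra.mem_centralizer_iff K).1 hA B hB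
  calc B * A⁻¹ = A⁻¹ * (A * B) * A⁻¹ := by
        rw [Matrix.nonsing_inv_mul_cancel_left _ _ hd.isUnit]
    _ = A⁻¹ * B := by rw [← h, mul_assoc, Matrix.mul_nonsing_inv_cancel_right _ _ hd.isUnit]

theorem isSymm_inv_mul {N A B : Matrix (Fin 3) (Fin 3) K} (hA : A ∈ bicommutant N)
    (hB : B ∈ bicommutant N) (hAs : A.IsSymm) (hBs : B.IsSymm) (hd : A.det ≠ 0) :
    (A⁻¹ * B).IsSymm := by
  rw [Matrix.IsSymm, Matrix.transpose_mul, Matrix.transpose_nonsing_inv, hAs.eq, hBs.eq]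
  exact mul_comm_of_mem_bicommutant hB (inv_mem_bicommutant hA hd)

/-- The theorem of Cayley and Hamilton for the adjugate matrix, divided by this matrix. -/
theorem adjugate_mul_adjugate_fin_three (M : Matrix (Fin 3) (Fin 3) K) :
    M.adjugate * M.adjugate =
      M.adjugate.trace • M.adjugate - (M.det * M.trace) • 1 + M.det • M := by
  ext i j
  fin_cases i <;> fin_cases j <;>
  simp [Matrix.mul_apply, Fin.sum_univ_three, Matrix.trace, Matrix.adjugate_fin_three,
    Matrix.det_fin_three] <;> ring

/-- The properties of the matrix of the chords `z (n - k) ∨ z (n + k)` that are proved by induction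
on `k`. The last one is Darboux's theorem that these chords touch a conic of the pencil of the two
given conics. -/
structure IsPencilChordMatrix (N : Matrix (Fin 3) (Fin 3) K) (z : ℤ → Fin 3 → K) (k : ℤ)
    (A : Matrix (Fin 3) (Fin 3) K) : Prop where
  isSymm : A.IsSymm
  mem_bicommutant : A ∈ bicommutant N
  isChordMatrix : IsChordMatrix z k A
  mul_self : ∃ x y : K, A * A = x • 1 + y • (N * N)

namespace IsHalfStepSequence

variable {N : Matrix (Fin 3) (Fin 3) K} {m : ℕ} {z : ℤ → Fin 3 → K}

theorem isPencilChordMatrix_one (h : IsHalfStepSequence N m z) (hNs : N.IsSymm) :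
    IsPencilChordMatrix N z 1 N :=
  ⟨hNs, self_mem_bicommutant N, h.isChordMatrix_one, 0, 1, by simp⟩

theorem isPencilChordMatrix_two (h : IsHalfStepSequence N m z) (h2 : (2 : K) ≠ 0) (hm : 3 ≤ m)
    (hNs : N.IsSymm) (hN : N.det ≠ 0) :
    IsPencilChordMatrix N z 2
      ((2 : K) • (N * N).adjugate - (N * N).adjugate.trace • 1) := by
  have hMd : (N * N).det ≠ 0 := by rw [Matrix.det_mul]; exact mul_ne_zero hN hN
  have hMm : N * N ∈ bicommutant N := mul_mem (self_mem_bicommutant N) (self_mem_bicommutant N)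
  have hadj : (N * N).adjugate = (N * N).det • (N * N)⁻¹ := by
    rw [Matrix.inv_def, Ring.inverse_eq_inv', smul_smul, mul_inv_cancel₀ hMd, one_smul]
  have hMs : (N * N).IsSymm := by rw [Matrix.IsSymm, Matrix.transpose_mul, hNs.eq]
  refine ⟨?_, ?_, h.isChordMatrix_two h2 hm hNs hN, ?_⟩
  · refine Matrix.IsSymm.sub (Matrix.IsSymm.smul ?_ _) (Matrix.isSymm_one.smul _)
    rw [Matrix.IsSymm, Matrix.adjugate_transpose, hMs.eq]
  · refine sub_mem (Subalgebra.smul_mem _ ?_ _) (Subalgebra.smul_mem _ (one_mem _) _)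
    rw [hadj]
    exact Subalgebra.smul_mem _ (inv_mem_bicommutant hMm hMd) _
  · generalize N * N = M
    refine ⟨M.adjugate.trace ^ 2 - 4 * M.det * M.trace, 4 * M.det, ?_⟩
    simp only [mul_sub, sub_mul, smul_mul_assoc, mul_smul_comm, mul_one, one_mul,
      adjugate_mul_adjugate_fin_three]
    module

theorem exists_isPencilChordMatrix_succ (h : IsHalfStepSequence N m z) (h2 : (2 : K) ≠ 0)
    (hNs : N.IsSymm) (hN : N.det ≠ 0) {k : ℤ} (hm1 : ¬ (m : ℤ) ∣ 1) (hk0 : ¬ (m : ℤ) ∣ k - 1)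
    (hk1 : ¬ (m : ℤ) ∣ k) (hkk : ¬ (m : ℤ) ∣ 2 * k) (hk2 : ¬ (m : ℤ) ∣ k + 1)
    {A B : Matrix (Fin 3) (Fin 3) K} (hA : IsPencilChordMatrix N z (k - 1) A)
    (hB : IsPencilChordMatrix N z k B) (hAB : ∃ x y : K, N * A * B = x • 1 + y • (N * N)) :
    ∃ E, IsPencilChordMatrix N z (k + 1) E ∧ ∃ x y : K, N * B * E = x • 1 + y • (N * N) := by
  have hBd := h.det_ne_zero h2 hB.isSymm hB.isChordMatrix hk1 hkk
  have hNm := self_mem_bicommutant N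
  have hBm := hB.mem_bicommutant
  have hNB := mul_comm_of_mem_bicommutant hNm hBm
  obtain ⟨x₀, y₀, h0⟩ := hAB
  obtain ⟨x₁, y₁, h1⟩ := hB.mul_self
  obtain ⟨x₂, y₂, h3⟩ := hA.mul_self
  have hx₁ : x₁ ≠ 0 := by
    rintro rfl
    rw [zero_smul, zero_add] at h1
    exact h.mul_self_ne_smul h2 hNs hN hB.isSymm hBd hB.isChordMatrix hm1 hk0 hk1 hk2 _ hNB h1
  -- `B * B` and `N * N` span the same plane as `1` and `N * N`.
  obtain ⟨x, y, hxy⟩ : ∃ x y : K, N * A * B = x • (N * N) + y • (B * B) := by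
    refine ⟨y₀ - x₀ * y₁ / x₁, x₀ / x₁, ?_⟩
    rw [h0, h1, smul_add, smul_smul, smul_smul, div_mul_cancel₀ _ hx₁, div_mul_eq_mul_div]
    module
  have hU : N * B⁻¹ = B⁻¹ * N :=
    mul_comm_of_mem_bicommutant hNm (inv_mem_bicommutant hBm hBd)
  have hUV : B⁻¹ * N * (N⁻¹ * B) = 1 := by
    rw [mul_assoc, Matrix.mul_nonsing_inv_cancel_left _ _ hN.isUnit,
      Matrix.nonsing_inv_mul _ hBd.isUnit]
  have hVU : N⁻¹ * B * (B⁻¹ * N) = 1 := by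
    rw [mul_assoc, Matrix.mul_nonsing_inv_cancel_left _ _ hBd.isUnit,
      Matrix.nonsing_inv_mul _ hN.isUnit]
  have hAe : A = x • (B⁻¹ * N) + y • (N⁻¹ * B) := by
    calc A = N⁻¹ * (N * A * B) * B⁻¹ := by
          rw [mul_assoc N, Matrix.nonsing_inv_mul_cancel_left _ _ hN.isUnit,
            Matrix.mul_nonsing_inv_cancel_right _ _ hBd.isUnit]
      _ = _ := by
          rw [hxy, mul_add, add_mul, mul_smul_comm, mul_smul_comm, smul_mul_assoc, smul_mul_assoc,
            Matrix.nonsing_inv_mul_cancel_left _ _ hN.isUnit, hU, ← mul_assoc N⁻¹ B B,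
            Matrix.mul_nonsing_inv_cancel_right _ _ hBd.isUnit]
  have hUm : B⁻¹ * N ∈ bicommutant N := mul_mem (inv_mem_bicommutant hBm hBd) hNm
  have hVm : N⁻¹ * B ∈ bicommutant N := mul_mem (inv_mem_bicommutant hNm hN) hBm
  refine ⟨x • (B⁻¹ * N) - y • (N⁻¹ * B), ⟨?_, ?_, ?_, ?_⟩, -y * x₁, x - y * y₁, ?_⟩
  · exact ((isSymm_inv_mul hBm hNm hB.isSymm hNs hBd).smul x).sub
      ((isSymm_inv_mul hNm hBm hNs hB.isSymm hN).smul y)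
  · exact sub_mem (Subalgebra.smul_mem _ hUm _) (Subalgebra.smul_mem _ hVm _)
  · exact h.isChordMatrix_succ h2 hNs hN hB.isSymm hBd hB.isChordMatrix hm1 hk0 hk1 hk2
      (hAe ▸ hA.isChordMatrix)
  · refine ⟨x₂ - 4 * x * y, y₂, ?_⟩
    have e : (x • (B⁻¹ * N) - y • (N⁻¹ * B)) * (x • (B⁻¹ * N) - y • (N⁻¹ * B)) =
        A * A - (4 * x * y) • 1 := by
      rw [hAe]
      simp only [mul_sub, sub_mul, mul_add, add_mul, smul_mul_assoc, mul_smul_comm, hUV, hVU]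
      module
    rw [e, h3]
    module
  · have e1 : N * B * (B⁻¹ * N) = N * N := by
      rw [mul_assoc, Matrix.mul_nonsing_inv_cancel_left _ _ hBd.isUnit]
    have e2 : N * B * (N⁻¹ * B) = B * B := by
      rw [hNB, mul_assoc, Matrix.mul_nonsing_inv_cancel_left _ _ hN.isUnit]
    rw [mul_sub, mul_smul_comm, mul_smul_comm, e1, e2, h1]
    module

/-- Two consecutive chord matrices `A` and `B`, with the relation between them that the induction
needs to find the next one. -/
theorem exists_isPencilChordMatrix (h : IsHalfStepSequence N m z) (h2 : (2 : K) ≠ 0)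
    (hNs : N.IsSymm) (hN : N.det ≠ 0) (k : ℕ) (hk : 2 * (k + 2) < m) :
    ∃ A B, IsPencilChordMatrix N z (k + 1) A ∧ IsPencilChordMatrix N z (k + 2) B ∧
      ∃ x y : K, N * A * B = x • 1 + y • (N * N) := by
  have hndvd : ∀ l : ℤ, 0 < l → l < m → ¬ (m : ℤ) ∣ l := fun l h0 hl hd => by
    have := Int.le_of_dvd h0 hd; omega
  induction k with
  | zero =>
    refine ⟨N, _, by simpa using h.isPencilChordMatrix_one hNs,
      by simpa using h.isPencilChordMatrix_two h2 (by omega) hNs hN,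
      2 * (N * N).det, -(N * N).adjugate.trace, ?_⟩
    rw [mul_sub, mul_smul_comm, mul_smul_comm, Matrix.mul_adjugate, mul_one]
    module
  | succ k ih =>
    obtain ⟨A, B, hA, hB, hAB⟩ := ih (by omega)
    obtain ⟨E, hE, hBE⟩ := h.exists_isPencilChordMatrix_succ h2 hNs hN (k := k + 2)
      (hndvd _ (by omega) (by omega)) (hndvd _ (by omega) (by omega))
      (hndvd _ (by omega) (by omega)) (hndvd _ (by omega) (by omega))
      (hndvd _ (by omega) (by omega)) (by convert hA using 1; ring) hB hAB
    exact ⟨B, E, by convert hB using 1; push_cast; ring, by convert hE using 1; push_cast; ring,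
      hBE⟩

/-- For `0 < k < m / 2`, the chords `z (n - k) ∨ z (n + k)` are the polar lines of the images of
the points `z n` under an invertible symmetric matrix. All of these matrices commute, as they are
in the bicommutant of `N`. -/
theorem exists_isChordMatrix (h : IsHalfStepSequence N m z) (h2 : (2 : K) ≠ 0)
    (hNs : N.IsSymm) (hN : N.det ≠ 0) (k : ℕ) (hk0 : 0 < k) (hk : 2 * k < m) :
    ∃ A ∈ bicommutant N, A.IsSymm ∧ A.det ≠ 0 ∧ IsChordMatrix z k A := by
  have hndvd : ∀ l : ℤ, 0 < l → l < m → ¬ (m : ℤ) ∣ l := fun l h0 hl hd => by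
    have := Int.le_of_dvd h0 hd; omega
  obtain ⟨A, hA⟩ : ∃ A, IsPencilChordMatrix N z k A := by
    obtain _ | _ | k := k
    · omega
    · exact ⟨N, by simpa using h.isPencilChordMatrix_one hNs⟩
    · obtain ⟨A, B, -, hB, -⟩ := h.exists_isPencilChordMatrix h2 hNs hN k hk
      exact ⟨B, by convert hB using 1; push_cast; ring⟩
  exact ⟨A, hA.mem_bicommutant, hA.isSymm, h.det_ne_zero h2 hA.isSymm hA.isChordMatrix
    (hndvd _ (by omega) (by omega)) (hndvd _ (by omega) (by omega)), hA.isChordMatrix⟩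

end IsHalfStepSequence

end ChordMatrices

/-! ### Half-steps of a Poncelet polygon, and rings in the projective plane -/

section HalfSteps

variable {K : Type*} [Field K] {m : ℕ}

theorem cross_eq_inv_smul_mulVec {N : Matrix (Fin 3) (Fin 3) K} (hNs : N.IsSymm) (hN : N.det ≠ 0)
    (x y : Fin 3 → K) : x ⨯₃ y = N.det⁻¹ • N *ᵥ ((N *ᵥ x) ⨯₃ (N *ᵥ y)) := by
  rw [mulVec_cross_mulVec' hN, Matrix.mulVec_smul, Matrix.transpose_nonsing_inv, hNs.eq,
    Matrix.mulVec_mulVec, Matrix.mul_nonsing_inv _ hN.isUnit, Matrix.one_mulVec, smul_smul,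
    inv_mul_cancel₀ hN, one_smul]

/-- A polygon inscribed in the conic `z ⬝ᵥ z = 0` is interlaced with the images `w i` under `N⁻¹`
of its edges, when these are on the same conic. -/
theorem exists_isHalfStepSequence (h2 : (2 : K) ≠ 0) (hm : 3 ≤ m)
    {N : Matrix (Fin 3) (Fin 3) K} (hNs : N.IsSymm) (hN : N.det ≠ 0) {u w : ZMod m → Fin 3 → K}
    (hu : ∀ i, u i ⬝ᵥ u i = 0) (hw : ∀ i, w i ⬝ᵥ w i = 0)
    (huu : ∀ i j, i ≠ j → u i ⨯₃ u j ≠ 0) (huw : ∀ i, u i ⨯₃ u (i + 1) = N *ᵥ w i) :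
    ∃ z : ℤ → Fin 3 → K, IsHalfStepSequence N m z ∧ ∀ i : ℤ, z (2 * i) = u i := by
  have h10 : ((1 : ℤ) : ZMod m) ≠ 0 := by
    rw [Ne, ZMod.intCast_zmod_eq_zero_iff_dvd]
    intro hd; have := Int.le_of_dvd one_pos hd; omega
  have h20 : ((2 : ℤ) : ZMod m) ≠ 0 := by
    rw [Ne, ZMod.intCast_zmod_eq_zero_iff_dvd]
    intro hd; have := Int.le_of_dvd two_pos hd; omega
  push_cast at h10 h20
  have h12 : ∀ i : ZMod m, i ≠ i + 1 := fun i hi => h10 (by linear_combination -hi)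
  have htriple : ∀ i j : ZMod m, u i ⬝ᵥ (u j ⨯₃ u (j + 1)) = 0 → i = j ∨ i = j + 1 := by
    intro i j h
    by_contra! hne
    exact dot_cross_ne_zero_of_null h2 (hu _) (hu _) (hu _) (huu _ _ hne.1) (huu _ _ hne.2)
      (huu _ _ (h12 j)) h
  -- Distinct edges of the polygon are distinct lines.
  have hww : ∀ i j, i ≠ j → w i ⨯₃ w j ≠ 0 := by
    intro i j hij h0
    have hl : (N *ᵥ w i) ⨯₃ (N *ᵥ w j) = 0 := by
      rw [mulVec_cross_mulVec, h0, Matrix.mulVec_zero]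
    rw [← huw, ← huw] at hl
    obtain ⟨c, hc⟩ := exists_eq_smul_of_cross_eq_zero (huu _ _ (h12 i)) hl
    have hc0 : c ≠ 0 := by
      rintro rfl
      exact huu _ _ (h12 j) (by rw [hc, zero_smul])
    have e1 := dot_self_cross (u j) (u (j + 1))
    have e2 := dot_cross_self (u j) (u (j + 1))
    rw [hc, dotProduct_smul, smul_eq_mul, mul_eq_zero, or_iff_right hc0] at e1 e2
    have f1 := (htriple _ _ e1).resolve_left hij.symm
    have f2 := (htriple _ _ e2).resolve_right fun h => hij (by linear_combination -h)
    exact h20 (by linear_combination f2 - f1)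
  set z : ℤ → Fin 3 → K := fun n => if Even n then u ((n / 2 : ℤ) : ZMod m)
    else w ((n / 2 : ℤ) : ZMod m) with hz
  have hz0 : ∀ i : ℤ, z (2 * i) = u i := by
    intro i
    simp [hz]
  have hz1 : ∀ i : ℤ, z (2 * i + 1) = w i := by
    intro i
    have : (2 * i + 1) / 2 = i := by omega
    simp [hz, this]
  have hcast : ∀ i k : ℤ, ¬ (m : ℤ) ∣ k → (i : ZMod m) ≠ ((i + k : ℤ) : ZMod m) := by
    intro i k hk h
    rw [ZMod.intCast_eq_intCast_iff_dvd_sub] at h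
    exact hk (by simpa using h)
  refine ⟨z, ⟨?_, ?_, ?_⟩, hz0⟩
  · intro n
    obtain ⟨i, rfl | rfl⟩ := Int.even_or_odd' n
    · rw [hz0, hu]
    · rw [hz1, hw]
  · intro n k hk
    obtain ⟨i, rfl | rfl⟩ := Int.even_or_odd' n
    · rw [hz0, show 2 * i + 2 * k = 2 * (i + k) by ring, hz0]
      exact huu _ _ (hcast i k hk)
    · rw [hz1, show 2 * i + 1 + 2 * k = 2 * (i + k) + 1 by ring, hz1]
      exact hww _ _ (hcast i k hk)
  · intro n
    obtain ⟨i, rfl | rfl⟩ := Int.even_or_odd' n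
    · obtain ⟨j, rfl⟩ : ∃ j, i = j + 1 := ⟨i - 1, by ring⟩
      rw [hz0, hz1, show 2 * (j + 1) - 1 = 2 * j + 1 by ring, hz1]
      push_cast
      refine ⟨N.det⁻¹ * (u j ⬝ᵥ (u (j + 1) ⨯₃ u (j + 1 + 1))), ?_, ?_⟩
      · refine mul_ne_zero (inv_ne_zero hN) fun h => ?_
        rcases htriple _ _ h with h | h
        · exact h12 _ h
        · exact h20 (by linear_combination -h)
      · rw [cross_eq_inv_smul_mulVec hNs hN, ← huw, ← huw, cross_cross_eq_smul_sub_smul,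
          dot_self_cross, zero_smul, sub_zero, Matrix.mulVec_smul, smul_smul]
    · refine ⟨1, one_ne_zero, ?_⟩
      rw [add_sub_cancel_right, hz0, hz1, show 2 * i + 1 + 1 = 2 * (i + 1) by ring, hz0, one_smul]
      push_cast
      exact huw _

end HalfSteps

section Representatives

variable {F : Type*} [Field F]

theorem exists_join_rep {p q : Point F} (h : p ≠ q) :
    ∃ c : F, c ≠ 0 ∧ (join p q).rep = c • (p.rep ⨯₃ q.rep) := by
  classical
  have hne := mt (Projectivization.mk_eq_mk_iff_crossProduct_eq_zero p.rep_nonzero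
    q.rep_nonzero).2 (by simpa using h)
  have e : join p q = Projectivization.mk F (p.rep ⨯₃ q.rep) hne := by
    have := Projectivization.cross_mk_of_ne p.rep_nonzero q.rep_nonzero (by simpa using h)
    simp only [Projectivization.mk_rep] at this
    exact this
  obtain ⟨a, ha⟩ := Projectivization.exists_smul_eq_mk_rep F (p.rep ⨯₃ q.rep) hne
  exact ⟨a, a.ne_zero, by rw [e]; exact ha.symm⟩

theorem incident_iff_rep {p : Point F} {l : Line F} : Incident p l ↔ p.rep ⬝ᵥ l.rep = 0 := by
  have := Projectivization.orthogonal_mk p.rep_nonzero l.rep_nonzero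
  rwa [Projectivization.mk_rep, Projectivization.mk_rep] at this

theorem eq_iff_rep_cross_eq_zero {p q : Point F} : p = q ↔ p.rep ⨯₃ q.rep = 0 := by
  have := Projectivization.mk_eq_mk_iff_crossProduct_eq_zero p.rep_nonzero q.rep_nonzero
  rwa [Projectivization.mk_rep, Projectivization.mk_rep] at this

/-- A tangent is the polar line of its point of contact. -/
theorem Conic.IsTangentAt.exists_rep {X : Conic F} {l : Line F} {q : Point F}
    (h : X.IsTangentAt l q) : ∃ c : F, l.rep = c • X.matrix *ᵥ q.rep := by
  have hX : X.matrix *ᵥ q.rep ≠ 0 := by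
    intro h0
    exact X.det_ne_zero (Matrix.exists_mulVec_eq_zero_iff.1 ⟨_, q.rep_nonzero, h0⟩)
  refine exists_eq_smul_of_cross_eq_zero hX ?_
  -- The points on `l` are the points `l ⨯₃ y`, and these are on the polar line of `q`.
  rw [← dotProduct_eq_zero_iff]
  intro y
  have key : (l.rep ⨯₃ y) ⬝ᵥ (X.matrix *ᵥ q.rep) = 0 := by
    by_cases hy : l.rep ⨯₃ y = 0
    · rw [hy, zero_dotProduct]
    · obtain ⟨a, ha⟩ := Projectivization.exists_smul_eq_mk_rep F (l.rep ⨯₃ y) hy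
      have hinc : Incident (Projectivization.mk F _ hy) l := by
        rw [incident_iff_rep, ← ha, Units.smul_def, smul_dotProduct, dotProduct_comm,
          dot_self_cross, smul_zero]
      have := (h.2 _).1 hinc
      rw [← ha, Units.smul_def, smul_dotProduct] at this
      exact (smul_eq_zero.1 this).resolve_left a.ne_zero
  rw [dotProduct_comm, triple_product_permutation, dotProduct_comm, ← key]

end Representatives

section Rings

variable {F : Type*} [Field F] {K : Type*} [Field K] [Algebra F K] {m : ℕ}

theorem algebraMap_comp_cross (v w : Fin 3 → F) :
    algebraMap F K ∘ (v ⨯₃ w) = (algebraMap F K ∘ v) ⨯₃ (algebraMap F K ∘ w) := by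
  ext i
  fin_cases i <;> simp [cross_apply]

theorem algebraMap_comp_smul (c : F) (v : Fin 3 → F) :
    algebraMap F K ∘ (c • v) = algebraMap F K c • (algebraMap F K ∘ v) := by
  ext i
  simp

theorem algebraMap_dot (v w : Fin 3 → F) :
    (algebraMap F K ∘ v) ⬝ᵥ (algebraMap F K ∘ w) = algebraMap F K (v ⬝ᵥ w) :=
  ((algebraMap F K).map_dotProduct v w).symm

theorem algebraMap_comp_eq_zero {v : Fin 3 → F} : algebraMap F K ∘ v = 0 ↔ v = 0 := by
  simp [funext_iff]

theorem algebraMap_comp_mulVec (A : Matrix (Fin 3) (Fin 3) F) (v : Fin 3 → F) :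
    algebraMap F K ∘ (A *ᵥ v) = A.map (algebraMap F K) *ᵥ (algebraMap F K ∘ v) := by
  ext i
  exact (algebraMap F K).map_mulVec A v i

/-- The cyclic sequence `R` of points or lines consists of the images `T *ᵥ z (2 * i + s)` of
points of the same parity of the sequence `z`. The vectors `z n` may have coordinates in an
extension `K` of the ground field. -/
def IsImageRing (z : ℤ → Fin 3 → K) (R : ZMod m → ℙ F (Fin 3 → F)) (T : Matrix (Fin 3) (Fin 3) K)
    (s : ℤ) : Prop :=
  ∀ i : ℤ, ∃ c : K, c ≠ 0 ∧ algebraMap F K ∘ (R i).rep = c • T *ᵥ z (2 * i + s)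

namespace IsImageRing

variable {N : Matrix (Fin 3) (Fin 3) K} {z : ℤ → Fin 3 → K} {R : ZMod m → ℙ F (Fin 3 → F)}
  {T : Matrix (Fin 3) (Fin 3) K} {s : ℤ}

theorem injective (hR : IsImageRing z R T s) (h : IsHalfStepSequence N m z) (hT : T.det ≠ 0) :
    Function.Injective R := by
  intro i j hij
  obtain ⟨i, rfl⟩ := ZMod.intCast_surjective i
  obtain ⟨j, rfl⟩ := ZMod.intCast_surjective j
  rw [ZMod.intCast_eq_intCast_iff_dvd_sub]
  by_contra hd
  obtain ⟨c, hc0, hc⟩ := hR i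
  obtain ⟨d, hd0, hd'⟩ := hR j
  have h0 : (c • T *ᵥ z (2 * i + s)) ⨯₃ (d • T *ᵥ z (2 * j + s)) = 0 := by
    rw [← hc, ← hd', hij, cross_self]
  rw [map_smul, map_smul, LinearMap.smul_apply, mulVec_cross_mulVec' hT, smul_smul,
    smul_smul] at h0
  have h1 := (smul_eq_zero.1 h0).resolve_left (by simp [hc0, hd0, hT])
  have hdet : (T⁻¹)ᵀ.det ≠ 0 := by
    rw [Matrix.det_transpose, Matrix.det_nonsing_inv, Ring.inverse_eq_inv']
    exact inv_ne_zero hT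
  exact hdet (Matrix.exists_mulVec_eq_zero_iff.1
    ⟨_, h.cross_ne_zero_of_sub (n := 2 * i + s) (n' := 2 * j + s) hd (by ring), h1⟩)

theorem unique {R' : ZMod m → ℙ F (Fin 3 → F)} (hR : IsImageRing z R T s)
    (hR' : IsImageRing z R' T s) : R = R' := by
  funext i
  obtain ⟨i, rfl⟩ := ZMod.intCast_surjective i
  obtain ⟨c, hc0, hc⟩ := hR i
  obtain ⟨d, hd0, hd⟩ := hR' i
  rw [eq_iff_rep_cross_eq_zero, ← algebraMap_comp_eq_zero (K := K), algebraMap_comp_cross, hc, hd]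
  simp [cross_self]

/-- Joining the points of a ring, or intersecting its lines, at distance `k`. -/
theorem join (hR : IsImageRing z R T s) (h : IsHalfStepSequence N m z) (hT : T.det ≠ 0) {k : ℤ}
    (hk : ¬ (m : ℤ) ∣ k) {A : Matrix (Fin 3) (Fin 3) K} (hA : IsChordMatrix z k A) :
    IsImageRing z (fun j => Poncelet.join (R j) (R (j + (k : ZMod m)))) ((T⁻¹)ᵀ * A) (s + k) := by
  intro i
  obtain ⟨c, hc0, hc⟩ := hR i
  obtain ⟨d, hd0, hd⟩ := hR (i + k)
  obtain ⟨e, he0, he⟩ := hA (2 * i + s + k)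
  have hne : R i ≠ R ((i : ZMod m) + (k : ZMod m)) := by
    intro heq
    have := hR.injective h hT heq
    rw [left_eq_add, ZMod.intCast_zmod_eq_zero_iff_dvd] at this
    exact hk this
  obtain ⟨a, ha0, ha⟩ := exists_join_rep hne
  push_cast at hd
  refine ⟨algebraMap F K a * c * d * T.det * e, by simp [ha0, hc0, hd0, hT, he0], ?_⟩
  rw [show 2 * i + s + k - k = 2 * i + s by ring,
    show 2 * i + s + k + k = 2 * (i + k) + s by ring] at he
  rw [ha, algebraMap_comp_smul, algebraMap_comp_cross, hc, hd, map_smul, map_smul,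
    LinearMap.smul_apply, mulVec_cross_mulVec' hT, he, Matrix.mulVec_smul, Matrix.mulVec_mulVec,
    ← add_assoc (2 * i)]
  module

/-- The incidences are exact because no three of the points `z (2 * i + s)` are collinear. -/
theorem incident_join_iff (hR : IsImageRing z R T s) (h : IsHalfStepSequence N m z)
    (h2 : (2 : K) ≠ 0) (hT : T.det ≠ 0) {k : ℤ} (hk : ¬ (m : ℤ) ∣ k) (i j : ZMod m) :
    Incident (R i) (Poncelet.join (R j) (R (j + (k : ZMod m)))) ↔
      j = i ∨ j = i - (k : ZMod m) := by
  obtain ⟨i, rfl⟩ := ZMod.intCast_surjective i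
  obtain ⟨j, rfl⟩ := ZMod.intCast_surjective j
  have hne : R j ≠ R ((j : ZMod m) + (k : ZMod m)) := by
    intro heq
    have := hR.injective h hT heq
    rw [left_eq_add, ZMod.intCast_zmod_eq_zero_iff_dvd] at this
    exact hk this
  obtain ⟨a, ha0, ha⟩ := exists_join_rep hne
  rw [incident_iff_rep, ha, dotProduct_smul, smul_eq_mul, mul_eq_zero, or_iff_right ha0]
  constructor
  · intro h0
    by_contra! hd
    obtain ⟨b, hb0, hb⟩ := hR i
    obtain ⟨c, hc0, hc⟩ := hR j
    obtain ⟨d, hd0, hd'⟩ := hR (j + k)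
    push_cast at hd'
    rw [← (algebraMap F K).injective.eq_iff, ← algebraMap_dot, algebraMap_comp_cross, hb, hc, hd',
      map_smul, map_smul, LinearMap.smul_apply, smul_dotProduct, dotProduct_smul, dotProduct_smul,
      mulVec_dot_cross_mulVec] at h0
    have hji : ¬ (m : ℤ) ∣ j - i := fun hd' => hd.1
      ((ZMod.intCast_eq_intCast_iff_dvd_sub _ _ _).2 hd').symm
    have hjki : ¬ (m : ℤ) ∣ (j + k) - i := fun hd' => hd.2 (by
      rw [eq_sub_iff_add_eq, ← Int.cast_add]
      exact ((ZMod.intCast_eq_intCast_iff_dvd_sub _ _ _).2 hd').symm)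
    have := dot_cross_ne_zero_of_null h2 (h.null (2 * i + s)) (h.null (2 * j + s))
      (h.null (2 * (j + k) + s)) (h.cross_ne_zero_of_sub hji (by ring))
      (h.cross_ne_zero_of_sub hjki (by ring)) (h.cross_ne_zero_of_sub hk (by ring))
    simp [hb0, hc0, hd0, hT, this] at h0
  · rintro (hj | hj)
    · rw [hj, dot_self_cross]
    · rw [hj, sub_add_cancel, dot_cross_self]

end IsImageRing

/-- The points of a Poncelet polygon are, up to a linear map, every other point of a sequence of
half-steps. The linear map takes the first conic to the standard one. -/
theorem IsPonceletPolygon.exists_isImageRing [IsAlgClosed K] (h2 : (2 : K) ≠ 0) (hm : 3 ≤ m)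
    {P : ZMod m → Point F} (hP : IsPonceletPolygon P) :
    ∃ (G N : Matrix (Fin 3) (Fin 3) K) (z : ℤ → Fin 3 → K), G.IsSymm ∧ G.det ≠ 0 ∧ N.IsSymm ∧
      N.det ≠ 0 ∧ IsHalfStepSequence N m z ∧ IsImageRing z P G⁻¹ 0 := by
  obtain ⟨hinj, C, X, hC, hX⟩ := hP
  have hmap : ∀ Y : Conic F, (Y.matrix.map (algebraMap F K)).IsSymm ∧
      (Y.matrix.map (algebraMap F K)).det ≠ 0 := by
    intro Y
    refine ⟨Y.isSymm.map _, ?_⟩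
    have := (algebraMap F K).map_det Y.matrix
    rw [RingHom.mapMatrix_apply] at this
    rw [← this]
    exact (map_ne_zero _).2 Y.det_ne_zero
  obtain ⟨G, hGs, hG⟩ := exists_isSymm_mul_self_eq h2 (hmap C).1 (hmap C).2
  have hGd : G.det ≠ 0 := by
    intro h0
    apply (hmap C).2
    rw [← hG, Matrix.det_mul, h0, zero_mul]
  have hGis : (G⁻¹).IsSymm := by rw [Matrix.IsSymm, Matrix.transpose_nonsing_inv, hGs.eq]
  set X' := X.matrix.map (algebraMap F K) with hX'
  obtain ⟨N, hNs, hN⟩ := exists_isSymm_mul_self_eq h2 (M := G⁻¹ * X' * G⁻¹)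
    (by rw [Matrix.IsSymm, Matrix.transpose_mul, Matrix.transpose_mul, hGis.eq, (hmap X).1.eq,
      mul_assoc])
    (by
      rw [Matrix.det_mul, Matrix.det_mul, Matrix.det_nonsing_inv, Ring.inverse_eq_inv']
      exact mul_ne_zero (mul_ne_zero (inv_ne_zero hGd) (hmap X).2) (inv_ne_zero hGd))
  have hNd : N.det ≠ 0 := by
    intro h0
    have h1 : (N * N).det = 0 := by rw [Matrix.det_mul, h0, zero_mul]
    rw [hN, Matrix.det_mul, Matrix.det_mul, Matrix.det_nonsing_inv, Ring.inverse_eq_inv'] at h1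
    exact mul_ne_zero (mul_ne_zero (inv_ne_zero hGd) (hmap X).2) (inv_ne_zero hGd) h1
  set v : ZMod m → Fin 3 → K := fun i => algebraMap F K ∘ (P i).rep with hv
  have hvv : ∀ i j, i ≠ j → v i ⨯₃ v j ≠ 0 := by
    intro i j hij h0
    rw [hv, ← algebraMap_comp_cross, algebraMap_comp_eq_zero, ← eq_iff_rep_cross_eq_zero] at h0
    exact hij (hinj h0)
  have h12 : ∀ i : ZMod m, i ≠ i + 1 := by
    intro i hi
    have h10 : ((1 : ℤ) : ZMod m) = 0 := by push_cast; linear_combination -hi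
    rw [ZMod.intCast_zmod_eq_zero_iff_dvd] at h10
    have := Int.le_of_dvd one_pos h10
    omega
  have hedge : ∀ i, ∃ (b : K) (q : Fin 3 → K), v i ⨯₃ v (i + 1) = b • X' *ᵥ q ∧
      q ⬝ᵥ X' *ᵥ q = 0 := by
    intro i
    obtain ⟨q, hq⟩ := hX i
    obtain ⟨c, hc⟩ := hq.exists_rep
    obtain ⟨a, ha0, ha⟩ := exists_join_rep (hinj.ne (h12 i))
    have hj : joins 1 P i = Poncelet.join (P i) (P (i + 1)) := by simp [joins]
    rw [hj, ha] at hc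
    refine ⟨algebraMap F K (a⁻¹ * c), algebraMap F K ∘ q.rep, ?_, ?_⟩
    · rw [hv, ← algebraMap_comp_cross, ← algebraMap_comp_mulVec, ← algebraMap_comp_smul, mul_smul,
        ← hc, smul_smul, inv_mul_cancel₀ ha0, one_smul]
    · rw [← algebraMap_comp_mulVec, algebraMap_dot, hq.1, map_zero]
  -- In the new coordinates the first conic is `1` and the second one is `G⁻¹ * X' * G⁻¹ = N * N`.
  obtain ⟨z, hz, hzu⟩ := exists_isHalfStepSequence h2 hm hNs hNd
    (u := fun i => G *ᵥ v i) (w := fun i => N⁻¹ *ᵥ ((G *ᵥ v i) ⨯₃ (G *ᵥ v (i + 1))))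
    (by
      intro i
      rw [mulVec_dot_of_isSymm hGs, Matrix.mulVec_mulVec, hG, hv, ← algebraMap_comp_mulVec,
        algebraMap_dot, hC i, map_zero])
    (by
      intro i
      obtain ⟨b, q, hb, hq⟩ := hedge i
      have e1 : N⁻¹ *ᵥ ((G *ᵥ v i) ⨯₃ (G *ᵥ v (i + 1))) = (G.det * b) • N *ᵥ (G *ᵥ q) := by
        have : N *ᵥ (G *ᵥ q) = N⁻¹ *ᵥ (G⁻¹ *ᵥ (X' *ᵥ q)) := by
          simp only [Matrix.mulVec_mulVec]
          congr 1
          rw [← Matrix.nonsing_inv_mul_cancel_left N (N * G) hNd.isUnit, ← mul_assoc N, hN,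
            Matrix.nonsing_inv_mul_cancel_right _ _ hGd.isUnit]
        rw [mulVec_cross_mulVec' hGd, hGis.eq, hb, this]
        simp only [Matrix.mulVec_smul, smul_smul]
      rw [e1, smul_dotProduct, dotProduct_smul, mulVec_dot_of_isSymm hNs, Matrix.mulVec_mulVec, hN,
        mulVec_dot_of_isSymm hGs, Matrix.mulVec_mulVec, Matrix.mulVec_mulVec, mul_assoc G,
        Matrix.nonsing_inv_mul_cancel_right _ _ hGd.isUnit,
        Matrix.mul_nonsing_inv_cancel_left _ _ hGd.isUnit, hq, smul_zero, smul_zero])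
    (by
      intro i j hij
      rw [Ne, mulVec_cross_mulVec]
      intro h0
      refine hvv i j hij ?_
      by_contra hne
      have := Matrix.exists_mulVec_eq_zero_iff.1 ⟨_, hne, h0⟩
      rw [Matrix.det_transpose, Matrix.det_adjugate] at this
      exact hGd (eq_zero_of_pow_eq_zero this))
    (by
      intro i
      rw [Matrix.mulVec_mulVec, Matrix.mul_nonsing_inv _ hNd.isUnit, Matrix.one_mulVec])
  refine ⟨G, N, z, hGs, hGd, hNs, hNd, hz, fun i => ⟨1, one_ne_zero, ?_⟩⟩
  rw [add_zero, hzu, one_smul, Matrix.mulVec_mulVec, Matrix.nonsing_inv_mul _ hGd.isUnit,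
    Matrix.one_mulVec]

end Rings

/-! ### Joins and meets of rings, and cycles of rings -/

section JoinsMeets

variable {F : Type*} [Field F] {K : Type*} [Field K] [Algebra F K] {m : ℕ}
  {N : Matrix (Fin 3) (Fin 3) K} {z : ℤ → Fin 3 → K} {R : ZMod m → ℙ F (Fin 3 → F)}
  {H X A : Matrix (Fin 3) (Fin 3) K} {s : ℤ}

/-- The invertible symmetric matrices in the bicommutant of `N`. -/
structure IsSymmUnit (N A : Matrix (Fin 3) (Fin 3) K) : Prop where
  mem : A ∈ bicommutant N
  isSymm : A.IsSymm
  det_ne_zero : A.det ≠ 0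

theorem det_inv_ne_zero {B : Matrix (Fin 3) (Fin 3) K} (hB : B.det ≠ 0) : B⁻¹.det ≠ 0 := by
  rw [Matrix.det_nonsing_inv, Ring.inverse_eq_inv']
  exact inv_ne_zero hB

theorem IsSymmUnit.one : IsSymmUnit N 1 := ⟨one_mem _, Matrix.isSymm_one, by simp⟩

theorem IsSymmUnit.inv_mul (hX : IsSymmUnit N X) (hA : IsSymmUnit N A) :
    IsSymmUnit N (X⁻¹ * A) :=
  ⟨mul_mem (inv_mem_bicommutant hX.mem hX.det_ne_zero) hA.mem,
    isSymm_inv_mul hX.mem hA.mem hX.isSymm hA.isSymm hX.det_ne_zero, by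
    rw [Matrix.det_mul]
    exact mul_ne_zero (det_inv_ne_zero hX.det_ne_zero) hA.det_ne_zero⟩

theorem IsChordMatrix.neg {k : ℤ} (hA : IsChordMatrix z k A) : IsChordMatrix z (-k) A := by
  intro n
  obtain ⟨c, hc0, hc⟩ := hA n
  refine ⟨-c, neg_ne_zero.2 hc0, ?_⟩
  rw [sub_neg_eq_add, ← sub_eq_add_neg, ← cross_anticomm, hc, neg_smul]

theorem inv_transpose_mul (hHs : H.IsSymm) (hXs : X.IsSymm) :
    ((H * X)⁻¹)ᵀ * A = H⁻¹ * (X⁻¹ * A) := by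
  rw [Matrix.mul_inv_rev, Matrix.transpose_mul, Matrix.transpose_nonsing_inv,
    Matrix.transpose_nonsing_inv, hHs.eq, hXs.eq, mul_assoc]

/-- `joins` and `meets` are the same operation, with spans of opposite sign. -/
theorem joins_eq (k : ℕ) : joins k R = fun j => join (R j) (R (j + ((k : ℤ) : ZMod m))) := by
  funext j
  simp [joins]

theorem meets_eq (k : ℕ) : meets k R = fun j => join (R j) (R (j + ((-k : ℤ) : ZMod m))) := by
  funext j
  simp only [meets, Int.cast_neg, Int.cast_natCast, ← sub_eq_add_neg]
  rfl

theorem incident_comm {p : Point F} {l : Line F} : Incident p l ↔ Incident l p :=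
  Projectivization.orthogonal_comm

theorem not_natCast_dvd {k : ℕ} (hk0 : 0 < k) (hk : 2 * k < m) : ¬ (m : ℤ) ∣ k := fun hd => by
  have := Int.le_of_dvd (by omega) hd
  omega

theorem IsImageRing.joins (hR : IsImageRing z R (H * X) s) (h : IsHalfStepSequence N m z)
    (h2 : (2 : K) ≠ 0) (hHs : H.IsSymm) (hH : H.det ≠ 0) (hX : IsSymmUnit N X) {k : ℕ}
    (hk0 : 0 < k) (hk : 2 * k < m) (hA : IsChordMatrix z k A) :
    IsImageRing z (joins k R) (H⁻¹ * (X⁻¹ * A)) (s + k) ∧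
      ∀ i j, Incident (R i) (Poncelet.joins k R j) ↔ j = i ∨ j = i - (k : ZMod m) := by
  have hT : (H * X).det ≠ 0 := by rw [Matrix.det_mul]; exact mul_ne_zero hH hX.det_ne_zero
  rw [joins_eq, ← inv_transpose_mul hHs hX.isSymm]
  refine ⟨hR.join h hT (not_natCast_dvd hk0 hk) hA, fun i j => ?_⟩
  rw [hR.incident_join_iff h h2 hT (not_natCast_dvd hk0 hk), Int.cast_natCast]

theorem IsImageRing.meets (hR : IsImageRing z R (H * X) s) (h : IsHalfStepSequence N m z)
    (h2 : (2 : K) ≠ 0) (hHs : H.IsSymm) (hH : H.det ≠ 0) (hX : IsSymmUnit N X) {k : ℕ}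
    (hk0 : 0 < k) (hk : 2 * k < m) (hA : IsChordMatrix z k A) :
    IsImageRing z (meets k R) (H⁻¹ * (X⁻¹ * A)) (s - k) ∧
      ∀ i j, Incident (Poncelet.meets k R i) (R j) ↔ j = i ∨ j = i - (k : ZMod m) := by
  have hT : (H * X).det ≠ 0 := by rw [Matrix.det_mul]; exact mul_ne_zero hH hX.det_ne_zero
  have hd : ¬ (m : ℤ) ∣ -k := by rw [dvd_neg]; exact not_natCast_dvd hk0 hk
  rw [meets_eq, ← inv_transpose_mul hHs hX.isSymm, sub_eq_add_neg]
  refine ⟨hR.join h hT hd hA.neg, fun i j => ?_⟩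
  rw [incident_comm, hR.incident_join_iff h h2 hT hd, Int.cast_neg, Int.cast_natCast,
    sub_neg_eq_add, eq_comm, eq_sub_iff_add_eq, eq_comm (a := i)]

end JoinsMeets

section CyclicRings

/-- Three rings `p r` of `m` points and three rings `l r` of `m` lines, arranged in a cycle
`p 0, l 0, p 1, l 1, p 2, l 2` in which consecutive rings have the incidences given by the spans
`k r` (between `p r` and `l r`) and `k' r` (between `p (r + 1)` and `l r`). The rings `p r` and
`l (r + 1)` are opposite. -/
structure IsCyclicRings {α β : Type*} {m : ℕ} (I : α → β → Prop) (p : Fin 3 → ZMod m → α)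
    (l : Fin 3 → ZMod m → β) (k k' : Fin 3 → ZMod m) : Prop where
  injective_point : ∀ r, Function.Injective (p r)
  injective_line : ∀ r, Function.Injective (l r)
  incident : ∀ r i j, I (p r i) (l r j) ↔ j = i ∨ j = i - k r
  incident' : ∀ r i j, I (p (r + 1) i) (l r j) ↔ j = i ∨ j = i - k' r
  ne_zero : ∀ r, k r ≠ 0
  ne_zero' : ∀ r, k' r ≠ 0
  ne : ∀ r, k r ≠ k' r
  add_ne_zero : ∀ r, k r + k' r ≠ 0
  ne' : ∀ r, k (r + 1) ≠ k' r
  add_ne_zero' : ∀ r, k (r + 1) + k' r ≠ 0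

namespace IsCyclicRings

variable {α β : Type*} {m : ℕ} {I : α → β → Prop} {p : Fin 3 → ZMod m → α}
  {l : Fin 3 → ZMod m → β} {k k' : Fin 3 → ZMod m}

/-- Interchanging points and lines reverses the cycle of rings. -/
theorem dual (h : IsCyclicRings I p l k k') :
    IsCyclicRings (fun b a => I a b) (fun r => l (-r)) (fun r => p (-r)) (fun r => -k (-r))
      (fun r => -k' (-(r + 1))) where
  injective_point r := h.injective_line _
  injective_line r := h.injective_point _
  incident r i j := by
    rw [h.incident, sub_neg_eq_add, eq_sub_iff_add_eq, eq_comm, eq_comm (a := j) (b := i + _)]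
  incident' r i j := by
    have := h.incident' (-(r + 1)) j i
    rw [neg_add, neg_add_cancel_right] at this
    rw [neg_add, this, sub_neg_eq_add, eq_comm, eq_sub_iff_add_eq, eq_comm (a := j) (b := i + _)]
  ne_zero r := neg_ne_zero.2 (h.ne_zero _)
  ne_zero' r := neg_ne_zero.2 (h.ne_zero' _)
  ne r := by
    have := h.ne' (-(r + 1))
    rw [neg_add, neg_add_cancel_right] at this
    rw [neg_add]
    exact neg_injective.ne this
  add_ne_zero r := by
    have := h.add_ne_zero' (-(r + 1))
    rw [neg_add, neg_add_cancel_right] at this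
    rw [neg_add, ← neg_add (k _), neg_ne_zero]
    exact this
  ne' r := neg_injective.ne (h.ne _)
  add_ne_zero' r := by
    rw [← neg_add (k _), neg_ne_zero]
    exact h.add_ne_zero _

/-- Two consecutive rings of points are disjoint: their points are on different pairs of lines of
the ring of lines between them. -/
theorem point_ne_point (h : IsCyclicRings I p l k k') (r : Fin 3) (i j : ZMod m) :
    p r i ≠ p (r + 1) j := by
  intro he
  have hl : ∀ x, (x = i ∨ x = i - k r) ↔ (x = j ∨ x = j - k' r) := fun x => by
    rw [← h.incident, ← h.incident', he]
  rcases (hl i).1 (Or.inl rfl) with h1 | h1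
  · rcases (hl (i - k r)).1 (Or.inr rfl) with h3 | h3
    · exact h.ne_zero r (by linear_combination h1 - h3)
    · exact h.ne r (by linear_combination h1 - h3)
  · rcases (hl j).2 (Or.inl rfl) with h3 | h3
    · exact h.ne_zero' r (by linear_combination h1 + h3)
    · exact h.add_ne_zero r (by linear_combination h1 + h3)

theorem injective_points (h : IsCyclicRings I p l k k') :
    Function.Injective fun x : Fin 3 × ZMod m => p x.1 x.2 := by
  rintro ⟨r, i⟩ ⟨r', j⟩ (he : p r i = p r' j)
  obtain rfl | rfl | rfl : r' = r ∨ r' = r + 1 ∨ r = r' + 1 := by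
    clear he
    decide +revert
  · rw [h.injective_point _ he]
  · exact absurd he (h.point_ne_point _ _ _)
  · exact absurd he.symm (h.point_ne_point _ _ _)

theorem injective_lines (h : IsCyclicRings I p l k k') :
    Function.Injective fun x : Fin 3 × ZMod m => l x.1 x.2 := by
  rintro ⟨r, i⟩ ⟨r', j⟩ he
  have := h.dual.injective_points (a₁ := (-r, i)) (a₂ := (-r', j)) (by simpa using he)
  simpa using this

theorem encard_points [NeZero m] (h : IsCyclicRings I p l k k') :
    (Set.range fun x : Fin 3 × ZMod m => p x.1 x.2).encard = (3 * m : ℕ) := by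
  rw [← Set.image_univ, h.injective_points.encard_image, Set.encard_univ,
    ENat.card_eq_coe_fintype_card,
    Fintype.card_prod, Fintype.card_fin, ZMod.card]

theorem encard_lines [NeZero m] (h : IsCyclicRings I p l k k') :
    (Set.range fun x : Fin 3 × ZMod m => l x.1 x.2).encard = (3 * m : ℕ) := by
  rw [← Set.image_univ, h.injective_lines.encard_image, Set.encard_univ,
    ENat.card_eq_coe_fintype_card,
    Fintype.card_prod, Fintype.card_fin, ZMod.card]

/-- The lines through the point `p r i` that the incidences between consecutive rings provide. -/
def prescribedLines (l : Fin 3 → ZMod m → β) (k k' : Fin 3 → ZMod m) (r : Fin 3) (i : ZMod m) :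
    Set β :=
  (fun x : Fin 3 × ZMod m => l x.1 x.2) ''
    {(r, i), (r, i - k r), (r + 2, i), (r + 2, i - k' (r + 2))}

theorem encard_prescribedLines (h : IsCyclicRings I p l k k') (r : Fin 3) (i : ZMod m) :
    (prescribedLines l k k' r i).encard = 4 := by
  have hr : r ≠ r + 2 := by decide +revert
  have h1 : i ≠ i - k r := fun e => h.ne_zero r (by linear_combination e)
  have h2 : i ≠ i - k' (r + 2) := fun e => h.ne_zero' (r + 2) (by linear_combination e)
  rw [prescribedLines, h.injective_lines.encard_image,
    Set.encard_insert_of_notMem (by simp [hr, h1]),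
    Set.encard_insert_of_notMem (by simp [hr]), Set.encard_pair (by simp [h2])]
  norm_num

theorem incident_prev (h : IsCyclicRings I p l k k') (r : Fin 3) (i j : ZMod m) :
    I (p r i) (l (r + 2) j) ↔ j = i ∨ j = i - k' (r + 2) := by
  have hr : r + 2 + 1 = r := by decide +revert
  have := h.incident' (r + 2) i j
  rwa [hr] at this

/-- Apart from the prescribed lines, only lines of the opposite ring can pass through `p r i`. -/
theorem linesThrough_eq (h : IsCyclicRings I p l k k') (r : Fin 3) (i : ZMod m) :
    {b ∈ Set.range fun x : Fin 3 × ZMod m => l x.1 x.2 | I (p r i) b} =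
      prescribedLines l k k' r i ∪ {b ∈ Set.range (l (r + 1)) | I (p r i) b} := by
  ext b
  simp only [prescribedLines, Set.mem_ofPred_eq, Set.mem_range, Prod.exists, Set.mem_union,
    Set.mem_image, Set.mem_insert_iff, Set.mem_singleton_iff, Prod.mk.injEq]
  constructor
  · rintro ⟨⟨r', j, rfl⟩, hb⟩
    obtain rfl | rfl | rfl : r' = r ∨ r' = r + 1 ∨ r' = r + 2 := by
      clear hb
      decide +revert
    · left
      rcases (h.incident _ _ _).1 hb with rfl | rfl
      · exact ⟨_, _, Or.inl ⟨rfl, rfl⟩, rfl⟩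
      · exact ⟨_, _, Or.inr (Or.inl ⟨rfl, rfl⟩), rfl⟩
    · exact Or.inr ⟨⟨j, rfl⟩, hb⟩
    · left
      rcases (h.incident_prev _ _ _).1 hb with rfl | rfl
      · exact ⟨_, _, Or.inr (Or.inr (Or.inl ⟨rfl, rfl⟩)), rfl⟩
      · exact ⟨_, _, Or.inr (Or.inr (Or.inr ⟨rfl, rfl⟩)), rfl⟩
  · rintro (⟨r', j, hrj, rfl⟩ | ⟨⟨j, rfl⟩, hb⟩)
    · refine ⟨⟨r', j, rfl⟩, ?_⟩
      rcases hrj with ⟨rfl, rfl⟩ | ⟨rfl, rfl⟩ | ⟨rfl, rfl⟩ | ⟨rfl, rfl⟩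
      · exact (h.incident _ _ _).2 (Or.inl rfl)
      · exact (h.incident _ _ _).2 (Or.inr rfl)
      · exact (h.incident_prev _ _ _).2 (Or.inl rfl)
      · exact (h.incident_prev _ _ _).2 (Or.inr rfl)
    · exact ⟨⟨_, _, rfl⟩, hb⟩

theorem four_le_encard_linesThrough (h : IsCyclicRings I p l k k') (r : Fin 3) (i : ZMod m) :
    4 ≤ {b ∈ Set.range fun x : Fin 3 × ZMod m => l x.1 x.2 | I (p r i) b}.encard := by
  rw [h.linesThrough_eq, ← h.encard_prescribedLines r i]
  exact Set.encard_le_encard Set.subset_union_left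

theorem encard_linesThrough_eq_four_iff (h : IsCyclicRings I p l k k') (r : Fin 3) (i : ZMod m) :
    {b ∈ Set.range fun x : Fin 3 × ZMod m => l x.1 x.2 | I (p r i) b}.encard = 4 ↔
      ∀ j, ¬ I (p r i) (l (r + 1) j) := by
  have h1 : r + 1 ≠ r := by decide +revert
  have h2 : r + 1 ≠ r + 2 := by decide +revert
  rw [h.linesThrough_eq]
  constructor
  · intro he j hj
    have hfin : (prescribedLines l k k' r i).Finite :=
      Set.finite_of_encard_eq_coe (k := 4) (h.encard_prescribedLines r i)
    have heq := hfin.eq_of_subset_of_encard_le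
      (Set.subset_union_left (t := {b ∈ Set.range (l (r + 1)) | I (p r i) b}))
      (he.trans (h.encard_prescribedLines r i).symm).le
    have hmem : l (r + 1) j ∈ prescribedLines l k k' r i := by
      rw [heq]
      exact Or.inr ⟨⟨j, rfl⟩, hj⟩
    obtain ⟨x, hx, hxj⟩ := hmem
    have hx' : x = (r + 1, j) := h.injective_lines hxj
    subst hx'
    simp [h1, h2] at hx
  · intro hn
    have : {b ∈ Set.range (l (r + 1)) | I (p r i) b} = ∅ := by
      ext b
      simp only [Set.mem_ofPred_eq, Set.mem_empty_iff_false, iff_false, not_and]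
      rintro ⟨j, rfl⟩
      exact hn j
    rw [this, Set.union_empty, h.encard_prescribedLines]

theorem range_neg {γ : Type*} (f : Fin 3 → ZMod m → γ) :
    (Set.range fun x : Fin 3 × ZMod m => f (-x.1) x.2) =
      Set.range fun x : Fin 3 × ZMod m => f x.1 x.2 := by
  ext y
  simp only [Set.mem_range, Prod.exists]
  exact ⟨fun ⟨r, i, h⟩ => ⟨-r, i, h⟩, fun ⟨r, i, h⟩ => ⟨-r, i, by rwa [neg_neg]⟩⟩

theorem isPreConfiguration {F : Type*} [Field F] [NeZero m] {p : Fin 3 → ZMod m → Point F}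
    {l : Fin 3 → ZMod m → Line F} (h : IsCyclicRings Incident p l k k') :
    IsPreConfiguration (3 * m) 4 (Set.range fun x : Fin 3 × ZMod m => p x.1 x.2)
      (Set.range fun x : Fin 3 × ZMod m => l x.1 x.2) := by
  refine ⟨h.encard_points, h.encard_lines, ?_, ?_⟩
  · rintro _ ⟨⟨r, i⟩, rfl⟩
    exact h.four_le_encard_linesThrough r i
  · rintro _ ⟨⟨r, i⟩, rfl⟩
    have := h.dual.four_le_encard_linesThrough (-r) i
    rw [range_neg p, neg_neg] at this
    exact this

theorem isConfiguration_iff {F : Type*} [Field F] [NeZero m] {p : Fin 3 → ZMod m → Point F}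
    {l : Fin 3 → ZMod m → Line F} (h : IsCyclicRings Incident p l k k') :
    IsConfiguration (3 * m) 4 (Set.range fun x : Fin 3 × ZMod m => p x.1 x.2)
      (Set.range fun x : Fin 3 × ZMod m => l x.1 x.2) ↔
      ∀ r i j, ¬ Incident (p r i) (l (r + 1) j) := by
  constructor
  · rintro ⟨-, -, h1, -⟩ r i
    exact (h.encard_linesThrough_eq_four_iff r i).1 (h1 _ ⟨(r, i), rfl⟩)
  · intro hn
    refine ⟨h.encard_points, h.encard_lines, ?_, ?_⟩
    · rintro _ ⟨⟨r, i⟩, rfl⟩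
      exact (h.encard_linesThrough_eq_four_iff r i).2 (hn r i)
    · rintro _ ⟨⟨r, i⟩, rfl⟩
      have := (h.dual.encard_linesThrough_eq_four_iff (-r) i).2 fun j => by
        have hr : -(-r + 1) + 1 = r := by decide +revert
        have := hn (-(-r + 1)) j i
        rw [hr] at this
        rwa [neg_neg]
      rw [range_neg p, neg_neg] at this
      exact this

end IsCyclicRings

theorem range_vecCons_three {γ : Type*} {m : ℕ} (f g h : ZMod m → γ) :
    (Set.range fun x : Fin 3 × ZMod m => (![f, g, h] : Fin 3 → ZMod m → γ) x.1 x.2) =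
      Set.range f ∪ Set.range g ∪ Set.range h := by
  ext y
  simp [Fin.exists_fin_succ, or_assoc]

end CyclicRings

end Poncelet

/-! ### The construction -/

theorem theoremA {𝕜 : Type*} [RCLike 𝕜] (m a b c : ℕ)
    (ha : 0 < a) (hb : 0 < b) (hc : 0 < c)
    (ham : 2 * a < m) (hbm : 2 * b < m) (hcm : 2 * c < m)
    (hab : a ≠ b) (hac : a ≠ c) (hbc : b ≠ c)
    (P : ZMod m → Poncelet.Point 𝕜) (hP : Poncelet.IsPonceletPolygon P)
    (L₁ L₂ L₃ : ZMod m → Poncelet.Line 𝕜) (P₁ P₂ : ZMod m → Poncelet.Point 𝕜)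
    (hL₁ : L₁ = Poncelet.joins a P) (hP₁ : P₁ = Poncelet.meets b L₁)
    (hL₂ : L₂ = Poncelet.joins c P₁) (hP₂ : P₂ = Poncelet.meets a L₂)
    (hL₃ : L₃ = Poncelet.joins b P₂)
    (S : Set (Poncelet.Point 𝕜)) (hS : S = Set.range P ∪ Set.range P₁ ∪ Set.range P₂)
    (T : Set (Poncelet.Line 𝕜)) (hT : T = Set.range L₁ ∪ Set.range L₂ ∪ Set.range L₃) :
    -- every join and every meet in the construction is one of distinct points or lines
    (Function.Injective L₁ ∧ Function.Injective P₁ ∧ Function.Injective L₂ ∧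
      Function.Injective P₂ ∧ Function.Injective L₃) ∧
    -- the construction closes up, with the original labels
    Poncelet.meets c (Poncelet.joins b (Poncelet.meets a (Poncelet.joins c
      (Poncelet.meets b (Poncelet.joins a P))))) = P ∧
    -- it gives `3m` points and `3m` lines with at least four-fold incidences
    Poncelet.IsPreConfiguration (3 * m) 4 S T ∧
    -- consecutive rings of points and lines have exactly the prescribed incidences
    (∀ i j, Poncelet.Incident (P i) (L₁ j) ↔ j = i ∨ j = i - (a : ZMod m)) ∧
    (∀ i j, Poncelet.Incident (P₁ i) (L₁ j) ↔ j = i ∨ j = i - (b : ZMod m)) ∧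
    (∀ i j, Poncelet.Incident (P₁ i) (L₂ j) ↔ j = i ∨ j = i - (c : ZMod m)) ∧
    (∀ i j, Poncelet.Incident (P₂ i) (L₂ j) ↔ j = i ∨ j = i - (a : ZMod m)) ∧
    (∀ i j, Poncelet.Incident (P₂ i) (L₃ j) ↔ j = i ∨ j = i - (b : ZMod m)) ∧
    (∀ i j, Poncelet.Incident (P i) (L₃ j) ↔ j = i ∨ j = i - (c : ZMod m)) ∧
    -- it is a `(3m_4)` configuration precisely if opposite rings have no accidental incidence
    (Poncelet.IsConfiguration (3 * m) 4 S T ↔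
      ∀ i j, ¬ Poncelet.Incident (P i) (L₂ j) ∧ ¬ Poncelet.Incident (P₁ i) (L₃ j) ∧
        ¬ Poncelet.Incident (P₂ i) (L₁ j)) := by
  open Poncelet in
  let K := AlgebraicClosure 𝕜
  have h2 : (2 : K) ≠ 0 := two_ne_zero
  have : NeZero m := ⟨by omega⟩
  obtain ⟨G, N, z, hGs, hGd, hNs, hNd, hz, hR₀⟩ := hP.exists_isImageRing (K := K) h2 (by omega)
  have hGis : (G⁻¹).IsSymm := by rw [Matrix.IsSymm, Matrix.transpose_nonsing_inv, hGs.eq]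
  have hGid : G⁻¹.det ≠ 0 := det_inv_ne_zero hGd
  have hGG : G⁻¹⁻¹ = G := Matrix.nonsing_inv_nonsing_inv _ hGd.isUnit
  obtain ⟨A, hAm, hAs, hAd, hA⟩ := hz.exists_isChordMatrix h2 hNs hNd a ha ham
  obtain ⟨B, hBm, hBs, hBd, hB⟩ := hz.exists_isChordMatrix h2 hNs hNd b hb hbm
  obtain ⟨C, hCm, hCs, hCd, hC⟩ := hz.exists_isChordMatrix h2 hNs hNd c hc hcm
  have sA : IsSymmUnit N A := ⟨hAm, hAs, hAd⟩
  have sB : IsSymmUnit N B := ⟨hBm, hBs, hBd⟩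
  have sC : IsSymmUnit N C := ⟨hCm, hCs, hCd⟩
  rw [← mul_one G⁻¹] at hR₀
  have s1 := IsSymmUnit.one.inv_mul sA
  have s2 := s1.inv_mul sB
  have s3 := s2.inv_mul sC
  have s4 := s3.inv_mul sA
  have s5 := s4.inv_mul sB
  obtain ⟨hR₁, I₁⟩ := hR₀.joins hz h2 hGis hGid IsSymmUnit.one ha ham hA
  rw [hGG, ← hL₁] at hR₁
  rw [← hL₁] at I₁
  obtain ⟨hR₂, I₂⟩ := hR₁.meets hz h2 hGs hGd s1 hb hbm hB
  rw [← hP₁] at hR₂ I₂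
  obtain ⟨hR₃, I₃⟩ := hR₂.joins hz h2 hGis hGid s2 hc hcm hC
  rw [hGG, ← hL₂] at hR₃
  rw [← hL₂] at I₃
  obtain ⟨hR₄, I₄⟩ := hR₃.meets hz h2 hGs hGd s3 ha ham hA
  rw [← hP₂] at hR₄ I₄
  obtain ⟨hR₅, I₅⟩ := hR₄.joins hz h2 hGis hGid s4 hb hbm hB
  rw [hGG, ← hL₃] at hR₅
  rw [← hL₃] at I₅
  obtain ⟨hR₆, I₆⟩ := hR₅.meets hz h2 hGs hGd s5 hc hcm hC
  -- Up to the factors `G` and `G⁻¹`, the ring `Lᵢ` or `Pᵢ` has the matrix `X⁻¹ * Y`, where `X` is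
  -- the matrix of the previous ring and `Y` is the chord matrix of the step. As these matrices
  -- commute, those of the six steps cancel.
  have e2 : (((1 : Matrix (Fin 3) (Fin 3) K)⁻¹ * A)⁻¹ * B)⁻¹ = B⁻¹ * A := by
    rw [inv_one, one_mul, Matrix.mul_inv_rev, Matrix.nonsing_inv_nonsing_inv _ hAd.isUnit]
  have e5 : ((B⁻¹ * A * C)⁻¹ * A)⁻¹ * B = C := by
    have hBi := inv_mem_bicommutant hBm hBd
    have hdet : IsUnit (B⁻¹ * A * C).det := by rw [← e2]; exact s3.det_ne_zero.isUnit
    rw [Matrix.mul_inv_rev, Matrix.nonsing_inv_nonsing_inv _ hdet,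
      mul_comm_of_mem_bicommutant hBi hAm, mul_assoc A,
      Matrix.nonsing_inv_mul_cancel_left _ _ hAd.isUnit, mul_comm_of_mem_bicommutant hBi hCm,
      Matrix.nonsing_inv_mul_cancel_right _ _ hBd.isUnit]
  have hclose : meets c L₃ = P := by
    refine IsImageRing.unique (z := z) (T := G⁻¹ * 1) (s := 0) ?_ hR₀
    convert hR₆ using 1
    · rw [e2, e5, Matrix.nonsing_inv_mul _ hCd.isUnit]
    · ring
  rw [hclose] at I₆
  have hdet : ∀ {H X : Matrix (Fin 3) (Fin 3) K}, H.det ≠ 0 → IsSymmUnit N X →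
      (H * X).det ≠ 0 := fun hH hX => by
    rw [Matrix.det_mul]; exact mul_ne_zero hH hX.det_ne_zero
  have j1 := hR₁.injective hz (hdet hGd s1)
  have j2 := hR₂.injective hz (hdet hGid s2)
  have j3 := hR₃.injective hz (hdet hGd s3)
  have j4 := hR₄.injective hz (hdet hGid s4)
  have j5 := hR₅.injective hz (hdet hGd s5)
  have hne : ∀ x : ℕ, 0 < x → 2 * x < m → (x : ZMod m) ≠ 0 := by
    intro x h0 h1 h
    rw [ZMod.natCast_eq_zero_iff] at h
    have := Nat.le_of_dvd h0 h
    omega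
  have hnn : ∀ x y : ℕ, 2 * x < m → 2 * y < m → x ≠ y → (x : ZMod m) ≠ y := by
    intro x y h0 h1 hxy h
    rw [ZMod.natCast_eq_natCast_iff', Nat.mod_eq_of_lt (by omega),
      Nat.mod_eq_of_lt (by omega)] at h
    exact hxy h
  have hadd : ∀ x y : ℕ, 0 < x → 2 * x < m → 2 * y < m → (x : ZMod m) + y ≠ 0 := by
    intro x y h0 h1 h3 h
    rw [← Nat.cast_add, ZMod.natCast_eq_zero_iff] at h
    have := Nat.le_of_dvd (by omega) h
    omega
  have hcyc : IsCyclicRings Incident ![P, P₁, P₂] ![L₁, L₂, L₃] ![(a : ZMod m), c, b]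
      ![(b : ZMod m), a, c] := by
    refine ⟨?_, ?_, ?_, ?_, ?_, ?_, ?_, ?_, ?_, ?_⟩ <;> intro r <;> fin_cases r
    exacts [hP.1, j2, j4, j1, j3, j5, I₁, I₃, I₅, I₂, I₄, I₆, hne a ha ham, hne c hc hcm,
      hne b hb hbm, hne b hb hbm, hne a ha ham, hne c hc hcm, hnn a b ham hbm hab,
      hnn c a hcm ham hac.symm, hnn b c hbm hcm hbc, hadd a b ha ham hbm, hadd c a hc hcm ham,
      hadd b c hb hbm hcm, hnn c b hcm hbm hbc.symm, hnn b a hbm ham hab.symm,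
      hnn a c ham hcm hac, hadd c b hc hcm hbm, hadd b a hb hbm ham, hadd a c ha ham hcm]
  have hS' := range_vecCons_three P P₁ P₂
  have hT' := range_vecCons_three L₁ L₂ L₃
  rw [← hS] at hS'
  rw [← hT] at hT'
  have hpre := hcyc.isPreConfiguration
  have hconf := hcyc.isConfiguration_iff
  rw [hS', hT'] at hpre hconf
  refine ⟨⟨j1, j2, j3, j4, j5⟩, ?_, hpre, I₁, I₂, I₃, I₄, I₅, I₆, hconf.trans ?_⟩
  · rw [← hL₁, ← hP₁, ← hL₂, ← hP₂, ← hL₃, hclose]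
  · constructor
    · exact fun h i j => ⟨h 0 i j, h 1 i j, h 2 i j⟩
    · intro h r i j
      fin_cases r
      exacts [(h i j).1, (h i j).2.1, (h i j).2.2]
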